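/- Let $G=(V,E)$ be a finite simple graph that is 4-regular, 2-connected and planar (that is, it has a combinatorial embedding, given by a cyclic ordering of the edges at each vertex, whose number $F$ of faces satisfies $|V|-|E|+F=2$). Then the partition function of $G$ admits a Pfaffian representation, in the following sense. Let $\mathcal C(G)$ be the set of all $C\subseteq E$ such that every vertex is incident with an even number of edges of $C$, and for $w:E\to(0,\infty)$ put $w(C)=\prod_{e\in C}w(e)$ and $Z_G(w)=\sum_{C\in\mathcal C(G)}w(C)$. The dart graph $\mathcal D(G)$ has as vertices the darts $(v,e)$, $v\in V$, $e\in E$ incident with $v$; two distinct darts $(v,e),(v',e')$ are adjacent if $v=v'$ or $e=e'$. Its edges of the second kind are identified with the elements of $E$. An incidence matrix is an antisymmetric complex matrix $A$ indexed by the darts with $A_{d,d'}=0$ whenever $d,d'$ are not adjacent in $\mathcal D(G)$. Given a perfect matching $M_0$ of $\mathcal D(G)$, let $A^{M_0}(w)$ be obtained from $A$ by multiplying the entries at each pair of darts $(v,e),(v',e)$ with $v\neq v'$ by $w(e)^{-1}$ if this pair belongs to $M_0$, and by $w(e)$ otherwise. Then there exist a perfect matching $M_0$ of $\mathcal D(G)$,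 an incidence matrix $A$ and a constant $\Lambda\in\mathbb C\setminus\{0\}$ such that for all $w:E\to(0,\infty)$, $$Z_G(w)=\frac1\Lambda\; w(M_0\cap E)\;\operatorname{Pf}\bigl(A^{M_0}(w)\bigr),$$ where the Pfaffian is taken with respect to some enumeration of the darts (another enumeration at most changes the sign of $\Lambda$). -/

import Mathlib

open scoped Nat

noncomputable section

namespace PfaffianIsing

/-! ### Graph-theoretic notions -/

/-- `2`-connected: more than two vertices, connected, and connected after removal of any
single vertex. -/
def IsTwoConnected {V : Type*} (G : SimpleGraph V) : Prop :=
  2 < Nat.card V ∧ G.Connected ∧ ∀ v : V, (G.induce {v}ᶜ).Connected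

/-- A rotation system on `G`: a permutation of the darts (half-edges) of `G` whose cycles are
exactly the sets of darts at the vertices, i.e. a cyclic ordering of the edges at every vertex.
The dart `(v, e)` with `e = {v, w}` is Mathlib's `G.Dart` with `fst = v`, `snd = w`. -/
structure RotationSystem {V : Type*} (G : SimpleGraph V) where
  /-- the next dart in the cyclic order around the same vertex -/
  next : Equiv.Perm G.Dart
  fst_next : ∀ d : G.Dart, (next d).fst = d.fst
  sameCycle : ∀ d d' : G.Dart, d.fst = d'.fst → next.SameCycle d d'

/-- Reversal of darts, as a permutation. -/
def dartSymm {V : Type*} (G : SimpleGraph V) : Equiv.Perm G.Dart :=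
  SimpleGraph.Dart.symm_involutive.toPerm

/-- The face-tracing permutation: traverse the edge, then turn to the next edge around the
vertex that has been reached. Its cycles are the oriented boundary walks of the faces. -/
def RotationSystem.facePerm {V : Type*} {G : SimpleGraph V} (ρ : RotationSystem G) :
    Equiv.Perm G.Dart :=
  ρ.next * dartSymm G

/-- The number of faces of a rotation system: the cycles of the face-tracing permutation, and
one face for every isolated vertex (which carries no dart). -/
def RotationSystem.numFaces {V : Type*} {G : SimpleGraph V} (ρ : RotationSystem G) : ℕ :=
  Nat.card (Quotient (Equiv.Perm.SameCycle.setoid ρ.facePerm))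
    + Nat.card {v : V // ∀ w, ¬ G.Adj v w}

/-- A finite graph is planar if it has a combinatorial embedding of genus zero: a rotation
system all of whose components satisfy Euler's relation `V - E + F = 2`. The Euler
characteristic of every component is at most `2`, so it is enough to ask for equality in the
sum over the components. For a connected graph this says `V - E + F = 2`. -/
def IsPlanar {V : Type*} (G : SimpleGraph V) : Prop :=
  ∃ ρ : RotationSystem G,
    (Nat.card V : ℤ) - Nat.card G.edgeSet + ρ.numFaces = 2 * Nat.card G.ConnectedComponent

/-! ### The partition function -/

/-- The closed curves on `G`: the sets of edges that contain an even number of the edges at each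
vertex (the elements of the cycle space). -/
def closedCurves {V : Type*} [Fintype V] [DecidableEq V] (G : SimpleGraph V)
    [DecidableRel G.Adj] : Finset (Finset (Sym2 V)) :=
  {C ∈ G.edgeFinset.powerset | ∀ v : V, Even (Finset.card {e ∈ C | v ∈ e})}

/-- The partition function `Z_G(w) = ∑_C ∏_{e ∈ C} w(e)`, the sum over all closed curves. -/
def partitionFunction {V : Type*} [Fintype V] [DecidableEq V] (G : SimpleGraph V)
    [DecidableRel G.Adj] (w : Sym2 V → ℝ) : ℝ :=
  ∑ C ∈ closedCurves G, ∏ e ∈ C, w e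

/-! ### The dart graph and incidence matrices -/

/-- The two darts `(v, e)`, `(v', e')` have `v ≠ v'` and `e = e'`; the edges of the dart graph
of this kind are identified with the edges of `G`. -/
def IsEdgePair {V : Type*} {G : SimpleGraph V} (d d' : G.Dart) : Prop :=
  d.fst ≠ d'.fst ∧ d.edge = d'.edge

/-- The dart graph of `G`: the vertices are the darts of `G`, and two distinct darts are adjacent
if they have the same vertex or the same edge. -/
def dartGraph {V : Type*} (G : SimpleGraph V) : SimpleGraph G.Dart where
  Adj d d' := d ≠ d' ∧ (d.fst = d'.fst ∨ d.edge = d'.edge)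
  symm := ⟨fun _ _ h => ⟨h.1.symm, h.2.imp Eq.symm Eq.symm⟩⟩
  loopless := ⟨fun _ h => h.1 rfl⟩

/-- An incidence matrix on the dart graph: an antisymmetric complex matrix, indexed by the darts,
whose entries vanish at pairs that are not edges of the dart graph. -/
structure IsIncidenceMatrix {V : Type*} (G : SimpleGraph V)
    (A : Matrix G.Dart G.Dart ℂ) : Prop where
  antisymm : A.transpose = -A
  eq_zero : ∀ d d' : G.Dart, ¬ (dartGraph G).Adj d d' → A d d' = 0

/-- The edges of `G` that correspond to dart-graph edges in the matching `M`. -/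
def matchedEdges {V : Type*} [Fintype V] [DecidableEq V] (G : SimpleGraph V)
    [DecidableRel G.Adj] (M : (dartGraph G).Subgraph) : Finset (Sym2 V) :=
  open Classical in
  {e ∈ G.edgeFinset | ∃ d d' : G.Dart, IsEdgePair d d' ∧ d.edge = e ∧ M.Adj d d'}

/-- The weighted incidence matrix of `(G, M, A, w)`: the entries of `A` at an edge `e` of `G` are
divided by `w e` if `e` is in the reference perfect matching `M`, and multiplied by `w e`
otherwise; the other entries are those of `A`. -/
def weightedMatrix {V : Type*} {G : SimpleGraph V} (M : (dartGraph G).Subgraph)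
    (A : Matrix G.Dart G.Dart ℂ) (w : Sym2 V → ℝ) : Matrix G.Dart G.Dart ℂ :=
  open Classical in
  Matrix.of fun d d' =>
    if IsEdgePair d d' then
      if M.Adj d d' then ((w d.edge)⁻¹ : ℂ) * A d d' else (w d.edge : ℂ) * A d d'
    else A d d'

/-- The Pfaffian of a matrix of order `2 n`. -/
def pfaffian {n : ℕ} (A : Matrix (Fin (2 * n)) (Fin (2 * n)) ℂ) : ℂ :=
  1 / (2 ^ n * (n ! : ℂ)) *
    ∑ σ : Equiv.Perm (Fin (2 * n)), ((Equiv.Perm.sign σ : ℤ) : ℂ) *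
      ∏ i : Fin n, A (σ ⟨2 * i, by omega⟩) (σ ⟨2 * i + 1, by omega⟩)

/-- The partition function on `G` admits a Pfaffian representation: for some perfect matching
`M` on the dart graph, incidence matrix `A` and constant `Λ ≠ 0`,
`Z_G(w) = Λ⁻¹ w(M ∩ E) Pf(A^{G,M}(w))` for all (positive) weight functions `w` on the edges.
The Pfaffian is taken along an enumeration of the darts; another enumeration can only change its
sign, which `Λ` absorbs. The values of `w` outside the edge set play no role. -/
def HasPfaffianRepresentation {V : Type*} [Fintype V] [DecidableEq V] (G : SimpleGraph V)
    [DecidableRel G.Adj] : Prop :=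
  ∃ (n : ℕ) (enum : Fin (2 * n) ≃ G.Dart) (M : (dartGraph G).Subgraph)
    (A : Matrix G.Dart G.Dart ℂ) (Λ : ℂ),
    M.IsPerfectMatching ∧ IsIncidenceMatrix G A ∧ Λ ≠ 0 ∧
    ∀ w : Sym2 V → ℝ, (∀ e ∈ G.edgeSet, 0 < w e) →
      (partitionFunction G w : ℂ) =
        1 / Λ * ((∏ e ∈ matchedEdges G M, w e : ℝ) : ℂ) *
          pfaffian ((weightedMatrix M A w).submatrix enum enum)

end PfaffianIsing

end

/-! Order the darts vertex by vertex and, at each vertex, along the rotation of a planar embedding.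
Let `A` be `1` above the diagonal inside each vertex and a sign, still to be chosen, on each edge.
Let `M₀` pair the darts inside each vertex, so that `w(M₀ ∩ E) = 1` and every edge entry is simply
multiplied by its weight. With suitable signs the identity then holds with `Λ = 1`.

The Pfaffian is the top coefficient of the product of the factors `1 + A a b ψ_a ψ_b` over `a < b`
in the Grassmann algebra (`pfaffian_eq_berezin`). The factors at one vertex multiply to the sum of
all even monomials in its darts, each with coefficient `1`; the edge factors choose a set `C` of
edges. A choice survives exactly when the darts not on `C` are even in number at every vertex, which
for degree four says that `C` is a closed curve. So the Pfaffian is a signed version of `Z_G`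
(`pfaffian_expansion`).

The sign of `C` combines two parities: the crossings among the chords that join the two darts of
each edge of `C`, and the inversions between used and unused darts. The second is additive over the
edges of `C`. The first is a quadratic form modulo 2, and edge signs can absorb it once it is linear
on the cycle space. Here planarity enters. By Euler's relation every cycle is a sum of face
boundaries (`RotationSystem.exists_faceBoundary_eq`), and the polar form of the crossing form at a
face boundary and a cycle reduces to vertex terms that telescope around each vertex and cancel
(`inversionForm_boundary`). The resulting linear functional extends to all dart vectors, and its
values determine the edge signs (`exists_crossingForm_eq_sum`, `neg_one_pow_crossings`). -/

noncomputable section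

namespace PfaffianIsing

open Finset

set_option linter.unusedSectionVars false

/-! ### Grassmann monomials, their signs, and the Berezin integral -/

section Grassmann

variable {D : Type*} [Fintype D] [LinearOrder D]

/-- The generator of the Grassmann algebra on `D` at the index `d`. -/
def gen (d : D) : ExteriorAlgebra ℂ (D → ℂ) := ExteriorAlgebra.ι ℂ (Pi.single d 1)

lemma gen_mul_self (d : D) : gen d * gen d = 0 := ExteriorAlgebra.ι_sq_zero _

lemma gen_mul_gen (a b : D) : gen a * gen b = -(gen b * gen a) :=
  eq_neg_of_add_eq_zero_left (ExteriorAlgebra.ι_add_mul_swap _ _)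

/-- The product of the generators with index in `S`, in increasing order. -/
def monomial (S : Finset D) : ExteriorAlgebra ℂ (D → ℂ) := ((S.sort (· ≤ ·)).map gen).prod

lemma monomial_empty : monomial (∅ : Finset D) = 1 := by simp [monomial]

lemma monomial_insert_of_lt {m : D} {S : Finset D} (h : ∀ x ∈ S, m < x) :
    monomial (insert m S) = gen m * monomial S := by
  have hm : m ∉ S := fun hm => lt_irrefl _ (h m hm)
  rw [monomial, Finset.sort_insert (r := (· ≤ ·)) (fun b hb => (h b hb).le) hm]
  simp [monomial]

lemma monomial_singleton (a : D) : monomial {a} = gen a := by simp [monomial]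

lemma gen_mul_monomial_of_mem {d : D} {S : Finset D} (hd : d ∈ S) : gen d * monomial S = 0 := by
  induction S using Finset.induction_on_min with
  | empty => simp at hd
  | insert m S hm ih =>
    rw [monomial_insert_of_lt hm, ← mul_assoc]
    rcases eq_or_ne d m with rfl | hne
    · rw [gen_mul_self, zero_mul]
    · rw [gen_mul_gen, neg_mul, mul_assoc, ih ((Finset.mem_insert.1 hd).resolve_left hne)]
      simp

lemma gen_mul_monomial {d : D} {S : Finset D} (hd : d ∉ S) :
    gen d * monomial S = (-1 : ℂ) ^ #{x ∈ S | x < d} • monomial (insert d S) := by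
  induction S using Finset.induction_on_min with
  | empty => simp [monomial]
  | insert m S hm ih =>
    have hmS : m ∉ S := fun h => lt_irrefl _ (hm m h)
    simp only [Finset.mem_insert, not_or] at hd
    rcases lt_or_gt_of_ne hd.1 with hlt | hlt
    · rw [monomial_insert_of_lt (m := d)]
      · rw [Finset.filter_false_of_mem]
        · simp
        · simp only [Finset.mem_insert, forall_eq_or_imp, not_lt]
          exact ⟨hlt.le, fun x hx => (hlt.trans (hm x hx)).le⟩
      · simp only [Finset.mem_insert, forall_eq_or_imp]
        exact ⟨hlt, fun x hx => hlt.trans (hm x hx)⟩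
    · rw [monomial_insert_of_lt hm, ← mul_assoc, gen_mul_gen, neg_mul, mul_assoc, ih hd.2,
        Finset.insert_comm, monomial_insert_of_lt (m := m) (S := insert d S), Finset.filter_insert,
        if_pos hlt, Finset.card_insert_of_notMem (by simp [hmS]), pow_succ]
      · simp
      · simp only [Finset.mem_insert, forall_eq_or_imp]
        exact ⟨hlt, hm⟩

/-- The number of pairs in `S × T` that are in decreasing order. -/
def inversions (S T : Finset D) : ℕ := ∑ a ∈ S, #{b ∈ T | b < a}

/-- Sorting the concatenated product moves each generator of `S` past the smaller generators of `T`,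
at the cost of one sign each. -/
lemma monomial_mul_monomial {S T : Finset D} (h : Disjoint S T) :
    monomial S * monomial T = (-1 : ℂ) ^ inversions S T • monomial (S ∪ T) := by
  induction S using Finset.induction_on_min with
  | empty => simp [monomial_empty, inversions]
  | insert m S hm ih =>
    have hmS : m ∉ S := fun h => lt_irrefl _ (hm m h)
    rw [Finset.disjoint_insert_left] at h
    rw [monomial_insert_of_lt hm, mul_assoc, ih h.2, mul_smul_comm,
      gen_mul_monomial (by simp [hmS, h.1]), smul_smul, ← pow_add, Finset.insert_union,
      inversions, inversions, Finset.sum_insert hmS, Finset.filter_union,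
      Finset.filter_false_of_mem (s := S) (fun x hx => (hm x hx).le.not_gt), Finset.empty_union,
      add_comm]

lemma monomial_mul_monomial_of_not_disjoint {S T : Finset D} (h : ¬ Disjoint S T) :
    monomial S * monomial T = 0 := by
  induction S using Finset.induction_on_min with
  | empty => simp at h
  | insert m S hm ih =>
    rw [monomial_insert_of_lt hm, mul_assoc]
    by_cases hST : Disjoint S T
    · rw [Finset.disjoint_insert_left] at h
      have hmT : m ∈ T := by tauto
      rw [monomial_mul_monomial hST, mul_smul_comm, gen_mul_monomial_of_mem (by simp [hmT]),
        smul_zero]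
    · rw [ih hST, mul_zero]

/-- A vector anticommutes with each of the two generators, so the two signs cancel. Products of
pairs can therefore be formed in a commutative ring, without fixing an order of the factors. -/
lemma gen_mul_gen_mem_center (a b : D) :
    gen a * gen b ∈ Subalgebra.center ℂ (ExteriorAlgebra ℂ (D → ℂ)) := by
  rw [Subalgebra.mem_center_iff]
  intro x
  induction x using ExteriorAlgebra.induction with
  | algebraMap r => exact Algebra.commutes _ _
  | ι m =>
    have h (c : D) : ExteriorAlgebra.ι ℂ m * gen c = -(gen c * ExteriorAlgebra.ι ℂ m) :=
      eq_neg_of_add_eq_zero_left (ExteriorAlgebra.ι_add_mul_swap _ _)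
    rw [← mul_assoc, h, neg_mul, mul_assoc, h, mul_neg, neg_neg, mul_assoc]
  | mul x y hx hy => rw [mul_assoc, hy, ← mul_assoc, hx, mul_assoc]
  | add x y hx hy => rw [add_mul, mul_add, hx, hy]

variable (D) in
/-- The centre of the Grassmann algebra on `D`. -/
abbrev GrassmannCenter : Type _ := Subalgebra.center ℂ (ExteriorAlgebra ℂ (D → ℂ))

/-- The product of two generators, as a central element. -/
def pair (a b : D) : GrassmannCenter D := ⟨gen a * gen b, gen_mul_gen_mem_center a b⟩

lemma pair_swap (a b : D) : pair b a = -pair a b := Subtype.ext (gen_mul_gen b a)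

lemma pair_self (a : D) : pair a a = 0 := Subtype.ext (gen_mul_self a)

lemma pair_mul_self (a b : D) : pair a b * pair a b = 0 := by
  apply Subtype.ext
  change gen a * gen b * (gen a * gen b) = 0
  rw [mul_assoc, ← mul_assoc (gen b), gen_mul_gen b a, neg_mul, mul_assoc, gen_mul_self]
  simp

/-- The coefficient of the product of all generators. -/
def berezin {N : ℕ} (enum : Fin N ≃ D) : ExteriorAlgebra ℂ (D → ℂ) →ₗ[ℂ] ℂ :=
  ExteriorAlgebra.liftAlternating
    (Function.update 0 N ((Pi.basisFun ℂ D).reindex enum.symm).det)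

lemma berezin_ofFn {N : ℕ} (enum : Fin N ≃ D) (f : Fin N → D) :
    berezin enum (List.ofFn fun i => gen (f i)).prod =
      ((Pi.basisFun ℂ D).reindex enum.symm).det fun i => Pi.single (f i) 1 := by
  have := ExteriorAlgebra.liftAlternating_apply_ιMulti (R := ℂ) (M := D → ℂ)
    (Function.update 0 N ((Pi.basisFun ℂ D).reindex enum.symm).det) (fun i => Pi.single (f i) 1)
  rw [ExteriorAlgebra.ιMulti_apply, Function.update_self] at this
  exact this

/-- `berezin` lifts a family of alternating maps that is the determinant in degree `N` and zero in
every other degree. -/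
lemma berezin_ofFn_of_ne {N k : ℕ} (enum : Fin N ≃ D) (hk : k ≠ N) (f : Fin k → D) :
    berezin enum (List.ofFn fun i => gen (f i)).prod = 0 := by
  have := ExteriorAlgebra.liftAlternating_apply_ιMulti (R := ℂ) (M := D → ℂ)
    (Function.update 0 N ((Pi.basisFun ℂ D).reindex enum.symm).det) (fun i => Pi.single (f i) 1)
  rw [ExteriorAlgebra.ιMulti_apply, Function.update_of_ne hk] at this
  exact this

lemma berezin_perm {N : ℕ} (enum : Fin N ≃ D) (σ : Equiv.Perm (Fin N)) :
    berezin enum (List.ofFn fun i => gen (enum (σ i))).prod = ((Equiv.Perm.sign σ : ℤ) : ℂ) := by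
  rw [berezin_ofFn]
  have h : (fun i => Pi.single (enum (σ i)) (1 : ℂ)) =
      ((Pi.basisFun ℂ D).reindex enum.symm) ∘ σ := by
    funext i
    simp
  rw [h, AlternatingMap.map_perm, Module.Basis.det_self]
  simp [Units.smul_def]

lemma berezin_of_not_injective {N : ℕ} (enum : Fin N ≃ D) (f : Fin N → D)
    (hf : ¬ Function.Injective f) :
    berezin enum (List.ofFn fun i => gen (f i)).prod = 0 := by
  rw [berezin_ofFn]
  simp only [Function.Injective, not_forall] at hf
  obtain ⟨i, j, hij, hne⟩ := hf
  exact AlternatingMap.map_eq_zero_of_eq _ _ (by simp [hij]) hne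

lemma berezin_monomial {N : ℕ} (enum : Fin N ≃o D) (S : Finset D) :
    berezin enum.toEquiv (monomial S) = if S = univ then 1 else 0 := by
  have hcard : Fintype.card D = N := by simpa using Fintype.card_congr enum.toEquiv.symm
  split_ifs with h
  · subst h
    have : ((univ : Finset D).sort (· ≤ ·)) = List.ofFn fun i => enum i := by
      refine List.Perm.eq_of_pairwise' (r := (· ≤ ·)) (Finset.pairwise_sort _ _) ?_ ?_
      · rw [List.pairwise_ofFn]
        exact fun i j hij => enum.monotone hij.le
      · rw [List.perm_ext_iff_of_nodup (Finset.sort_nodup _ _)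
          (List.nodup_ofFn.2 enum.injective)]
        intro a
        simp [List.mem_ofFn, enum.surjective a]
    rw [monomial, this, List.map_ofFn]
    simpa [Function.comp_def] using berezin_perm enum.toEquiv 1
  · have hS : #S ≠ N := by
      rw [← hcard]
      exact fun hS => h (Finset.card_eq_iff_eq_univ _ |>.1 hS)
    have : monomial S = (List.ofFn fun i : Fin #S => gen (S.orderEmbOfFin rfl i)).prod := by
      rw [monomial]
      congr 1
      rw [← List.ofFn_get (S.sort _), List.map_ofFn, List.ofFn_congr (Finset.length_sort _)]
      rfl
    rw [this, berezin_ofFn_of_ne _ hS]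

end Grassmann

/-! ### The Pfaffian as a Berezin integral -/

section PfaffianBerezin

variable {D : Type*} [Fintype D] [LinearOrder D]

lemma coe_prod_pair (k : ℕ) (g : Fin (2 * k) → D) :
    ((∏ i : Fin k, pair (g ⟨2 * i, by omega⟩) (g ⟨2 * i + 1, by omega⟩) : GrassmannCenter D) :
      ExteriorAlgebra ℂ (D → ℂ)) = (List.ofFn fun j => gen (g j)).prod := by
  rw [List.ofFn_mul', List.prod_flatten, List.map_ofFn, ← List.prod_ofFn]
  change (Subalgebra.val (Subalgebra.center ℂ (ExteriorAlgebra ℂ (D → ℂ)))) _ = _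
  rw [map_list_prod, List.map_ofFn]
  congr 2
  funext i
  simp [pair, List.ofFn_succ]

lemma berezin_prod_pair_of_card_ne {n : ℕ} (enum : Fin (2 * n) ≃ D) (I : Finset (D × D))
    (hI : #I ≠ n) :
    berezin enum ((∏ p ∈ I, pair p.1 p.2 : GrassmannCenter D) : ExteriorAlgebra ℂ (D → ℂ)) = 0 := by
  have h1 : ∏ p ∈ I, pair p.1 p.2 =
      ∏ i : Fin #I, pair (I.equivFin.symm i).1.1 (I.equivFin.symm i).1.2 := by
    rw [← Finset.prod_coe_sort]
    exact (Equiv.prod_comp I.equivFin.symm (fun p : I => pair p.1.1 p.1.2)).symm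
  let g : Fin (2 * #I) → D := fun j =>
    if j.1 % 2 = 0 then (I.equivFin.symm ⟨j / 2, by omega⟩).1.1
    else (I.equivFin.symm ⟨j / 2, by omega⟩).1.2
  have h2 := coe_prod_pair #I g
  have h3 (i : Fin #I) : (2 * (i : ℕ) + 1) / 2 = i := by omega
  have h4 (i : Fin #I) : (2 * (i : ℕ) + 1) % 2 = 1 := by omega
  simp only [g, Nat.mul_mod_right, if_true, h4, Nat.mul_div_cancel_left _ Nat.two_pos, h3,
    one_ne_zero, if_false] at h2
  rw [h1, h2]
  exact berezin_ofFn_of_ne enum (by omega) g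

/-- The `n`-th power expands over sequences of `n` pairs, that is, of `2 * n` darts. Sequences with
a repetition integrate to zero and permutations to their signs, which leaves the sum that defines
the Pfaffian. -/
lemma berezin_quadratic_pow {n : ℕ} (enum : Fin (2 * n) ≃ D) (A : Matrix D D ℂ) :
    berezin enum (((∑ p : D × D, A p.1 p.2 • pair p.1 p.2) ^ n : GrassmannCenter D) :
      ExteriorAlgebra ℂ (D → ℂ)) = 2 ^ n * (n ! : ℂ) * pfaffian (A.submatrix enum enum) := by
  have hbij : Function.Bijective (fun (h : Fin (2 * n) → Fin (2 * n)) (i : Fin n) =>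
      (enum (h ⟨2 * i, by omega⟩), enum (h ⟨2 * i + 1, by omega⟩))) := by
    constructor
    · intro h h' hh
      funext j
      have := congrFun hh ⟨j / 2, by omega⟩
      simp only [Prod.mk.injEq, EmbeddingLike.apply_eq_iff_eq] at this
      rcases Nat.mod_two_eq_zero_or_one j with hj | hj
      · convert this.1 using 2 <;> exact Fin.ext (by simp; omega)
      · convert this.2 using 2 <;> exact Fin.ext (by simp; omega)
    · intro f
      refine ⟨fun j => if j.1 % 2 = 0 then enum.symm (f ⟨j / 2, by omega⟩).1
        else enum.symm (f ⟨j / 2, by omega⟩).2, ?_⟩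
      funext i
      have h3 : (2 * (i : ℕ) + 1) / 2 = i := by omega
      have h4 : (2 * (i : ℕ) + 1) % 2 = 1 := by omega
      simp [h3, h4]
  rw [Fintype.sum_pow, ← hbij.sum_comp]
  simp only [Finset.prod_smul]
  rw [← Subalgebra.coe_val, map_sum, map_sum]
  simp only [map_smul, smul_eq_mul, Subalgebra.coe_val]
  have key (h : Fin (2 * n) → Fin (2 * n)) := coe_prod_pair n (fun j => enum (h j))
  simp only [key]
  have : ∑ h : Fin (2 * n) → Fin (2 * n),
      (∏ i : Fin n, A (enum (h ⟨2 * i, by omega⟩)) (enum (h ⟨2 * i + 1, by omega⟩))) *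
        berezin enum (List.ofFn fun j => gen (enum (h j))).prod =
      ∑ σ : Equiv.Perm (Fin (2 * n)),
      (∏ i : Fin n, A (enum (σ ⟨2 * i, by omega⟩)) (enum (σ ⟨2 * i + 1, by omega⟩))) *
        berezin enum (List.ofFn fun j => gen (enum (σ j))).prod := by
    symm
    refine Finset.sum_of_injOn (fun σ : Equiv.Perm (Fin (2 * n)) => (σ : Fin (2 * n) → Fin (2 * n)))
      (fun σ _ τ _ h => DFunLike.coe_injective h) (fun _ _ => by simp) ?_ (fun _ _ => rfl)
    intro h _ hh
    rw [berezin_of_not_injective, mul_zero]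
    intro hinj
    have hi : Function.Injective h := fun i j hij => hinj (by simp [hij])
    exact hh ⟨Equiv.ofBijective h (Finite.injective_iff_bijective.1 hi), by simp, rfl⟩
  rw [this]
  simp only [berezin_perm]
  rw [pfaffian, ← mul_assoc, mul_one_div_cancel, one_mul]
  · exact Finset.sum_congr rfl fun σ _ => mul_comm _ _
  · exact mul_ne_zero (pow_ne_zero _ two_ne_zero) (Nat.cast_ne_zero.2 n.factorial_ne_zero)

/-- Only squarefree terms survive, and each occurs in `k !` orders. Thus the powers of a sum of such
elements are multiples of the homogeneous parts of `∏ (1 + y i)`. -/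
lemma sum_pow_of_mul_self_eq_zero {R ι : Type*} [CommRing R] [DecidableEq ι] (y : ι → R)
    (hy : ∀ i, y i * y i = 0) (s : Finset ι) (k : ℕ) :
    (∑ i ∈ s, y i) ^ k = (k ! : R) * ∑ I ∈ s.powersetCard k, ∏ i ∈ I, y i := by
  induction s using Finset.induction_on generalizing k with
  | empty =>
    cases k with
    | zero => simp
    | succ k =>
      rw [Finset.powersetCard_eq_empty.2 (by simp)]
      simp
  | insert a s ha ih =>
    cases k with
    | zero => simp
    | succ k =>
      have hpow (Y : R) (m : ℕ) : (y a + Y) ^ (m + 1) = Y ^ (m + 1) + (m + 1) * (y a * Y ^ m) := by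
        induction m with
        | zero => simp; ring
        | succ m ihm =>
          rw [pow_succ, ihm]
          push_cast
          linear_combination (m + 1) * Y ^ m * hy a
      rw [Finset.sum_insert ha, hpow, ih, ih, Finset.powersetCard_succ_insert ha,
        Finset.sum_union, Finset.sum_image]
      · rw [mul_add, Nat.factorial_succ]
        congr 1
        rw [Finset.mul_sum (s.powersetCard k) (fun I => ∏ i ∈ insert a I, y i)]
        push_cast
        rw [Finset.mul_sum, Finset.mul_sum, Finset.mul_sum]
        refine Finset.sum_congr rfl fun I hI => ?_
        rw [Finset.prod_insert fun h => ha ((Finset.mem_powersetCard.1 hI).1 h)]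
        ring
      · intro I hI J hJ h
        have hI := fun h => ha ((Finset.mem_powersetCard.1 hI).1 h)
        have hJ := fun h => ha ((Finset.mem_powersetCard.1 hJ).1 h)
        rw [← Finset.erase_insert hI, ← Finset.erase_insert hJ, h]
      · rw [Finset.disjoint_left]
        intro I hI hI'
        obtain ⟨J, _, rfl⟩ := Finset.mem_image.1 hI'
        exact ha ((Finset.mem_powersetCard.1 hI).1 (Finset.mem_insert_self _ _))

/-- The Pfaffian as a Berezin integral. -/
lemma pfaffian_eq_berezin {n : ℕ} (enum : Fin (2 * n) ≃ D) (A : Matrix D D ℂ)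
    (hA : A.transpose = -A) :
    pfaffian (A.submatrix enum enum) =
      berezin enum ((∏ p : D × D with p.1 < p.2, (1 + A p.1 p.2 • pair p.1 p.2) :
        GrassmannCenter D) : ExteriorAlgebra ℂ (D → ℂ)) := by
  have hA' (a b : D) : A b a = -A a b := congrFun (congrFun hA a) b
  set P : Finset (D × D) := {p : D × D | p.1 < p.2} with hP
  -- Both `A` and `pair` change sign when the indices are swapped, so the two orders of a pair
  -- contribute equally; the diagonal vanishes.
  have hsum : ∑ p : D × D, A p.1 p.2 • pair p.1 p.2 =
      (2 : ℂ) • ∑ p ∈ P, A p.1 p.2 • pair p.1 p.2 := by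
    rw [← Finset.sum_filter_add_sum_filter_not univ (fun p : D × D => p.1 < p.2), two_smul]
    congr 1
    rw [← Finset.sum_filter_add_sum_filter_not _ (fun p : D × D => p.2 < p.1),
      Finset.sum_eq_zero (s := {p ∈ {p : D × D | ¬ p.1 < p.2} | ¬ p.2 < p.1}), add_zero]
    · refine Finset.sum_nbij' Prod.swap Prod.swap ?_ ?_ ?_ ?_ ?_
      · rintro ⟨a, b⟩ h
        simp [hP] at h ⊢
        exact h.2
      · rintro ⟨a, b⟩ h
        simp [hP] at h ⊢
        exact ⟨h.le, h⟩
      · simp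
      · simp
      · rintro ⟨a, b⟩ h
        simp only [Prod.fst_swap, Prod.snd_swap, hA' a b, pair_swap a b, smul_neg, neg_smul]
        exact (neg_neg _).symm
    · rintro ⟨a, b⟩ h
      simp only [not_lt, mem_filter, mem_univ, true_and] at h
      rw [le_antisymm h.1 h.2, pair_self, smul_zero]
  have h := berezin_quadratic_pow enum A
  have hfac : (n ! : ℂ) ≠ 0 := Nat.cast_ne_zero.2 n.factorial_ne_zero
  rw [hsum, smul_pow, sum_pow_of_mul_self_eq_zero, ← Subalgebra.coe_val, map_smul,
    map_smul, smul_eq_mul, mul_assoc, mul_right_inj' (pow_ne_zero _ two_ne_zero),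
    ← nsmul_eq_mul, ← Nat.cast_smul_eq_nsmul ℂ, map_smul, map_smul, smul_eq_mul,
    mul_right_inj' hfac] at h
  -- The full product also contains sets of a number of pairs other than `n`; they integrate to zero
  -- for degree reasons.
  · rw [← h, Finset.prod_one_add, ← Subalgebra.coe_val, map_sum, map_sum, map_sum, map_sum]
    refine Finset.sum_subset (fun I hI => Finset.mem_powerset.2 (Finset.mem_powersetCard.1 hI).1)
      fun I hI hI' => ?_
    rw [Finset.prod_smul, map_smul, map_smul, Subalgebra.coe_val, berezin_prod_pair_of_card_ne,
      smul_zero]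
    exact fun hc => hI' (Finset.mem_powersetCard.2 ⟨Finset.mem_powerset.1 hI, hc⟩)
  · intro p
    rw [smul_mul_smul_comm, pair_mul_self, smul_zero]

end PfaffianBerezin

/-! ### All-ones blocks and even monomials -/

section Blocks

variable {D : Type*} [Fintype D] [LinearOrder D]

lemma sum_neg_one_pow_card_lt (T : Finset D) :
    ∑ b ∈ T, (-1 : ℂ) ^ #{x ∈ T | x < b} = if Odd #T then 1 else 0 := by
  induction T using Finset.induction_on_max with
  | empty => simp
  | insert m T hm ih =>
    have hmT : m ∉ T := fun h => lt_irrefl _ (hm m h)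
    rw [Finset.sum_insert hmT, Finset.filter_insert, if_neg (lt_irrefl m),
      Finset.filter_true_of_mem hm, Finset.card_insert_of_notMem hmT,
      Finset.sum_congr rfl (g := fun b => (-1 : ℂ) ^ #{x ∈ T | x < b}), ih]
    · rcases Nat.even_or_odd #T with h | h
      · simp [h, h.add_one]
      · simp [h]
    · intro b hb
      rw [Finset.filter_insert, if_neg (hm b hb).le.not_gt]

/-- A monomial on an odd set `T` arises once for each `b ∈ T`, by removing `b`, and the signs
alternate along `T`: `1 - 1 + ... + 1 = 1`. -/
lemma sum_gen_mul_sum_even (X : Finset D) :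
    (∑ b ∈ X, gen b) * ∑ S ∈ X.powerset with Even #S, monomial S =
      ∑ S ∈ X.powerset with Odd #S, monomial S := by
  have h1 (T : Finset D) (hT : T ∈ ({S ∈ X.powerset | Odd #S} : Finset (Finset D))) :
      monomial T = ∑ b ∈ T, (-1 : ℂ) ^ #{x ∈ T | x < b} • monomial T := by
    rw [← Finset.sum_smul, sum_neg_one_pow_card_lt, if_pos (Finset.mem_filter.1 hT).2, one_smul]
  rw [Finset.sum_congr rfl h1, Finset.sum_mul_sum, ← Finset.sum_product', Finset.sum_sigma',
    ← Finset.sum_filter_of_ne (p := fun q => q.1 ∉ q.2)]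
  · refine Finset.sum_bij' (fun q _ => ⟨insert q.1 q.2, q.1⟩) (fun q _ => (q.2, q.1.erase q.2))
      ?_ ?_ ?_ ?_ ?_
    · rintro ⟨b, S⟩ h
      simp only [mem_filter, mem_product, mem_powerset] at h
      simp only [mem_sigma, mem_filter, mem_powerset, mem_insert_self, and_true]
      refine ⟨Finset.insert_subset h.1.1 h.1.2.1, ?_⟩
      rw [Finset.card_insert_of_notMem h.2]
      exact h.1.2.2.add_one
    · rintro ⟨T, b⟩ h
      simp only [mem_sigma, mem_filter, mem_powerset] at h
      simp only [mem_filter, mem_product, mem_powerset, notMem_erase, not_false_eq_true, and_true]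
      refine ⟨h.1.1 h.2, (Finset.erase_subset _ _).trans h.1.1, ?_⟩
      rw [Finset.card_erase_of_mem h.2]
      exact Nat.Odd.sub_odd h.1.2 odd_one
    · rintro ⟨b, S⟩ h
      simp only [mem_filter] at h
      simp [h.2]
    · rintro ⟨T, b⟩ h
      simp only [mem_sigma] at h
      simp [h.2]
    · rintro ⟨b, S⟩ h
      simp only [mem_filter] at h
      rw [gen_mul_monomial h.2, Finset.filter_insert, if_neg (lt_irrefl b)]
  · rintro ⟨b, S⟩ _ hne hmem
    exact hne (gen_mul_monomial_of_mem hmem)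

lemma pair_mul_pair_left (a b c : D) : pair a b * pair a c = 0 := by
  apply Subtype.ext
  change gen a * gen b * (gen a * gen c) = 0
  rw [mul_assoc, ← mul_assoc (gen b), gen_mul_gen b a, neg_mul, mul_assoc (gen a), mul_neg,
    ← mul_assoc, gen_mul_self, zero_mul, neg_zero]

lemma prod_one_add_pair_left (a : D) (X : Finset D) :
    ∏ b ∈ X, (1 + pair a b) = 1 + ∑ b ∈ X, pair a b := by
  induction X using Finset.induction_on with
  | empty => simp
  | insert c X hc ih =>
    rw [Finset.prod_insert hc, Finset.sum_insert hc, ih]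
    have h : pair a c * ∑ b ∈ X, pair a b = 0 := by
      rw [Finset.mul_sum]
      exact Finset.sum_eq_zero fun b _ => pair_mul_pair_left a c b
    have hring {R : Type _} [CommRing R] (x y : R) (hxy : x * y = 0) :
        (1 + x) * (1 + y) = 1 + (x + y) := by linear_combination hxy
    exact hring _ _ h

/-- The product over all pairs of a block is the sum of its even monomials. -/
lemma prod_one_add_pair_block (X : Finset D) :
    ((∏ p ∈ X ×ˢ X with p.1 < p.2, (1 + pair p.1 p.2) : GrassmannCenter D) :
      ExteriorAlgebra ℂ (D → ℂ)) = ∑ S ∈ X.powerset with Even #S, monomial S := by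
  induction X using Finset.induction_on_min with
  | empty => simp [Finset.filter_singleton, monomial_empty]
  | insert a X ha ih =>
    have haX : a ∉ X := fun h => lt_irrefl _ (ha a h)
    have hsplit : ({p ∈ insert a X ×ˢ insert a X | p.1 < p.2} : Finset (D × D)) =
        X.image (fun b => (a, b)) ∪ {p ∈ X ×ˢ X | p.1 < p.2} := by
      ext ⟨b, c⟩
      simp only [mem_filter, mem_product, mem_insert, mem_union, mem_image, Prod.mk.injEq]
      constructor
      · rintro ⟨⟨rfl | hb, rfl | hc⟩, h⟩
        · exact absurd h (lt_irrefl _)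
        · exact Or.inl ⟨c, hc, rfl, rfl⟩
        · exact absurd h (ha _ hb).le.not_gt
        · exact Or.inr ⟨⟨hb, hc⟩, h⟩
      · rintro (⟨c, hc, rfl, rfl⟩ | ⟨⟨hb, hc⟩, h⟩)
        · exact ⟨⟨Or.inl rfl, Or.inr hc⟩, ha _ hc⟩
        · exact ⟨⟨Or.inr hb, Or.inr hc⟩, h⟩
    -- With the least element `a` split off, the product is `(1 + a ∑ b)` times the even part of
    -- `X`, that is, the even part plus `a` times the odd part.
    rw [hsplit, Finset.prod_union, Finset.prod_image, prod_one_add_pair_left,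
      Subalgebra.coe_mul, ih, Subalgebra.coe_add, Subalgebra.coe_one]
    · have h1 : ((∑ b ∈ X, pair a b : GrassmannCenter D) : ExteriorAlgebra ℂ (D → ℂ)) =
          gen a * ∑ b ∈ X, gen b := by
        rw [← Subalgebra.coe_val, map_sum, Finset.mul_sum]
        rfl
      rw [h1, add_mul, one_mul, mul_assoc, sum_gen_mul_sum_even, Finset.powerset_insert,
        Finset.filter_union, Finset.sum_union, Finset.filter_image, Finset.sum_image,
        Finset.mul_sum]
      · congr 1
        refine Finset.sum_congr ?_ ?_
        · ext S
          simp only [mem_filter, mem_powerset, and_congr_right_iff]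
          intro hS
          rw [Finset.card_insert_of_notMem fun h => haX (hS h), Nat.even_add_one, Nat.not_even_iff_odd]
        · intro S hS
          rw [monomial_insert_of_lt]
          simp only [mem_filter, mem_powerset] at hS
          exact fun x hx => ha x (hS.1 hx)
      · intro I hI J hJ h
        simp only [coe_filter, mem_powerset, Set.mem_ofPred_eq] at hI hJ
        rw [← Finset.erase_insert fun h => haX (hI.1 h), ← Finset.erase_insert fun h => haX (hJ.1 h),
          h]
      · rw [Finset.disjoint_left]
        intro I hI hI'
        simp only [mem_filter, mem_powerset, mem_image] at hI hI'
        obtain ⟨⟨J, _, rfl⟩, _⟩ := hI'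
        exact haX (hI.1 (Finset.mem_insert_self _ _))
    · simp
    · rw [Finset.disjoint_left]
      rintro ⟨b, c⟩ h h'
      simp only [mem_image, Prod.mk.injEq, mem_filter, mem_product] at h h'
      obtain ⟨c, _, rfl, rfl⟩ := h
      exact haX h'.1.1

variable {V : Type*} [Fintype V] [LinearOrder V] {vert : D → V}

/-- Blocks are intervals of the order, so a dart outside the block lies below all of `S` or below
none of it. Hence even monomials of different blocks multiply without a sign. -/
lemma even_inversions_of_block (hvert : Monotone vert) {S T : Finset D} {v : V}
    (hS : ∀ a ∈ S, vert a = v) (hT : ∀ b ∈ T, vert b ≠ v) (hev : Even #S) :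
    Even (inversions S T) := by
  have h (a : D) (ha : a ∈ S) : #{b ∈ T | b < a} = #{b ∈ T | vert b < v} := by
    congr 1
    refine Finset.filter_congr fun b hb => ⟨fun hlt => ?_, fun hlt => ?_⟩
    · exact lt_of_le_of_ne (hS a ha ▸ hvert hlt.le) (hT b hb)
    · rw [← hS a ha] at hlt
      exact hvert.reflect_lt hlt
  rw [inversions, Finset.sum_congr rfl h, Finset.sum_const, smul_eq_mul]
  exact hev.mul_right _

/-- The product over all pairs inside blocks is the sum of the blockwise even monomials. -/
lemma prod_one_add_pair_blocks (hvert : Monotone vert) (U : Finset V) :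
    ((∏ p : D × D with p.1 < p.2 ∧ vert p.1 = vert p.2 ∧ vert p.1 ∈ U, (1 + pair p.1 p.2) :
        GrassmannCenter D) : ExteriorAlgebra ℂ (D → ℂ)) =
      ∑ S : Finset D with (∀ x ∈ S, vert x ∈ U) ∧ ∀ v, Even #{x ∈ S | vert x = v},
        monomial S := by
  induction U using Finset.induction_on with
  | empty =>
    have : ({S : Finset D | (∀ x ∈ S, vert x ∈ (∅ : Finset V)) ∧
        ∀ v, Even #{x ∈ S | vert x = v}} : Finset (Finset D)) = {∅} := by
      ext S
      simp only [notMem_empty, imp_false, mem_filter, mem_univ, true_and, mem_singleton,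
        ← Finset.eq_empty_iff_forall_notMem]
      exact ⟨fun h => h.1, fun h => ⟨h, by simp [h]⟩⟩
    rw [this]
    simp [monomial_empty]
  | insert v U hv ih =>
    set X : Finset D := {x | vert x = v} with hX
    have hsplit : ({p : D × D | p.1 < p.2 ∧ vert p.1 = vert p.2 ∧ vert p.1 ∈ insert v U} :
        Finset (D × D)) = {p ∈ X ×ˢ X | p.1 < p.2} ∪
          ({p : D × D | p.1 < p.2 ∧ vert p.1 = vert p.2 ∧ vert p.1 ∈ U} : Finset (D × D)) := by
      ext ⟨b, c⟩
      simp only [hX, mem_filter, mem_univ, true_and, mem_insert, mem_union, mem_product]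
      constructor
      · rintro ⟨h1, h2, h3 | h3⟩
        · exact Or.inl ⟨⟨h3, h2 ▸ h3⟩, h1⟩
        · exact Or.inr ⟨h1, h2, h3⟩
      · rintro (⟨⟨h1, h2⟩, h3⟩ | ⟨h1, h2, h3⟩)
        · exact ⟨h3, h1.trans h2.symm, Or.inl h1⟩
        · exact ⟨h1, h2, Or.inr h3⟩
    rw [hsplit, Finset.prod_union, Subalgebra.coe_mul, ih, prod_one_add_pair_block,
      Finset.sum_mul_sum, ← Finset.sum_product']
    · refine Finset.sum_bij' (fun q _ => q.1 ∪ q.2)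
        (fun T _ => ({x ∈ T | vert x = v}, {x ∈ T | vert x ≠ v})) ?_ ?_ ?_ ?_ ?_
      · rintro ⟨S, T⟩ h
        simp only [hX, mem_product, mem_filter, mem_powerset, mem_univ, true_and,
          Finset.subset_iff] at h
        simp only [mem_filter, mem_univ, true_and, mem_union, mem_insert]
        refine ⟨?_, fun u => ?_⟩
        · rintro x (hx | hx)
          · exact Or.inl (h.1.1 hx)
          · exact Or.inr (h.2.1 x hx)
        · rw [Finset.filter_union]
          rcases eq_or_ne u v with rfl | hu
          · rw [Finset.filter_true_of_mem fun x hx => h.1.1 hx,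
              Finset.filter_false_of_mem (s := T) fun x hx (hxu : vert x = u) =>
                hv (hxu ▸ h.2.1 x hx), union_empty]
            exact h.1.2
          · rw [Finset.filter_false_of_mem (s := S) fun x hx (hxu : vert x = u) =>
              hu (hxu ▸ h.1.1 hx), empty_union]
            exact h.2.2 u
      · intro T h
        simp only [mem_filter, mem_univ, true_and, mem_insert] at h
        simp only [hX, mem_product, mem_filter, mem_powerset, mem_univ, true_and,
          Finset.subset_iff]
        refine ⟨⟨fun _ hx => hx.2, h.2 v⟩, fun x hx => (h.1 x hx.1).resolve_left hx.2, fun u => ?_⟩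
        rw [Finset.filter_filter]
        rcases eq_or_ne u v with rfl | hu
        · rw [Finset.filter_false_of_mem fun x _ hx => hx.1 hx.2]
          simp
        · convert h.2 u using 3
          constructor
          · exact fun hx => hx.2
          · exact fun hx => ⟨hx ▸ hu, hx⟩
      · rintro ⟨S, T⟩ h
        simp only [hX, mem_product, mem_filter, mem_powerset, mem_univ, true_and,
          Finset.subset_iff] at h
        have hT (x) (hx : x ∈ T) : vert x ≠ v := fun hxu => hv (hxu ▸ h.2.1 x hx)
        rw [Finset.filter_union, Finset.filter_union,
          Finset.filter_true_of_mem fun x hx => h.1.1 hx, Finset.filter_false_of_mem hT,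
          Finset.filter_true_of_mem hT, Finset.filter_false_of_mem fun x hx => by simp [h.1.1 hx]]
        simp
      · intro T _
        exact Finset.filter_union_filter_not_eq _ _
      · rintro ⟨S, T⟩ h
        simp only [hX, mem_product, mem_filter, mem_powerset, mem_univ, true_and,
          Finset.subset_iff] at h
        have hT (x) (hx : x ∈ T) : vert x ≠ v := fun hxu => hv (hxu ▸ h.2.1 x hx)
        rw [monomial_mul_monomial, (even_inversions_of_block hvert h.1.1 hT h.1.2).neg_one_pow,
          one_smul]
        rw [Finset.disjoint_left]
        exact fun x hx hx' => hT x hx' (h.1.1 hx)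
    · rw [Finset.disjoint_left]
      rintro ⟨b, c⟩ h h'
      simp only [hX, mem_filter, mem_product, mem_univ, true_and] at h h'
      exact hv (h.1.1 ▸ h'.2.2)

end Blocks

/-! ### The Pfaffian as a signed sum over sets of chords -/

section PfaffianExpansion

variable {D : Type*} [Fintype D] [LinearOrder D] (bar : D → D)

/-- The representatives of the orbits of the involution `bar` that are the smaller elements. -/
def lowerDarts : Finset D := {c | c < bar c}

/-- The elements of the orbits of `bar` that are represented in `C`. -/
def orbitSupport (C : Finset D) : Finset D := C ∪ C.image bar

/-- The elements of the orbits of `bar` that are not represented in `C`. -/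
def orbitCompl (C : Finset D) : Finset D := (orbitSupport bar C)ᶜ

/-- The number of crossings of the chords that are represented in `C`, up to parity. -/
def crossings (C : Finset D) : ℕ :=
  ∑ c ∈ C, ∑ c' ∈ C with c < c', inversions {c, bar c} {c', bar c'}

variable {bar}

lemma mem_orbitCompl {C : Finset D} {d : D} : d ∈ orbitCompl bar C ↔ d ∉ orbitSupport bar C :=
  mem_compl

lemma orbitSupport_insert (c : D) (C : Finset D) :
    orbitSupport bar (insert c C) = {c, bar c} ∪ orbitSupport bar C := by
  ext x
  simp only [orbitSupport, image_insert, mem_union, mem_insert, mem_singleton]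
  tauto

lemma disjoint_orbitSupport (hbar : Function.Involutive bar) {c : D} {C : Finset D}
    (hc : c ∈ lowerDarts bar) (hC : C ⊆ lowerDarts bar) (hcC : c ∉ C) :
    Disjoint {c, bar c} (orbitSupport bar C) := by
  have hlow {x : D} (hx : x ∈ lowerDarts bar) : bar x ∉ lowerDarts bar := by
    simp only [lowerDarts, mem_filter, mem_univ, true_and, hbar x] at hx ⊢
    exact hx.le.not_gt
  simp only [orbitSupport, disjoint_union_right, disjoint_insert_left, disjoint_singleton_left,
    mem_image, not_exists, not_and]
  refine ⟨⟨hcC, fun h => hlow hc (hC h)⟩, fun x hx hxc => ?_, fun x hx hxc => ?_⟩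
  · exact hlow (hC hx) (hxc ▸ hc)
  · exact hcC (hbar.injective hxc ▸ hx)

lemma mem_orbitSupport_of_mem_lowerDarts (hbar : Function.Involutive bar) {c : D} {C : Finset D}
    (hc : c ∈ lowerDarts bar) (hC : C ⊆ lowerDarts bar) : c ∈ orbitSupport bar C ↔ c ∈ C := by
  refine ⟨fun h => ?_, fun h => Finset.mem_union_left _ h⟩
  by_contra hcC
  exact Finset.disjoint_left.1 (disjoint_orbitSupport hbar hc hC hcC) (by simp) h

lemma inversions_union_right {S T T' : Finset D} (h : Disjoint T T') :
    inversions S (T ∪ T') = inversions S T + inversions S T' := by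
  rw [inversions, inversions, inversions, ← Finset.sum_add_distrib]
  refine Finset.sum_congr rfl fun a _ => ?_
  rw [Finset.filter_union, Finset.card_union_of_disjoint (Finset.disjoint_filter_filter h)]

lemma inversions_union_left {S S' T : Finset D} (h : Disjoint S S') :
    inversions (S ∪ S') T = inversions S T + inversions S' T := by
  rw [inversions, Finset.sum_union h]
  rfl

lemma inversions_orbitSupport_right (hbar : Function.Involutive bar) (S : Finset D)
    {C : Finset D} (hC : C ⊆ lowerDarts bar) :
    inversions S (orbitSupport bar C) = ∑ c ∈ C, inversions S {c, bar c} := by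
  induction C using Finset.induction_on with
  | empty => simp [orbitSupport, inversions]
  | insert c C hc ih =>
    obtain ⟨h1, h2⟩ := Finset.insert_subset_iff.1 hC
    rw [orbitSupport_insert, inversions_union_right (disjoint_orbitSupport hbar h1 h2 hc), ih h2,
      Finset.sum_insert hc]

lemma inversions_orbitSupport_left (hbar : Function.Involutive bar) (T : Finset D)
    {C : Finset D} (hC : C ⊆ lowerDarts bar) :
    inversions (orbitSupport bar C) T = ∑ c ∈ C, inversions {c, bar c} T := by
  induction C using Finset.induction_on with
  | empty => simp [orbitSupport, inversions]
  | insert c C hc ih =>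
    obtain ⟨h1, h2⟩ := Finset.insert_subset_iff.1 hC
    rw [orbitSupport_insert, inversions_union_left (disjoint_orbitSupport hbar h1 h2 hc), ih h2,
      Finset.sum_insert hc]

/-- Each factor is an increasing monomial, and multiplying by the chord with the least lower end
costs its inversions with the later chords. For `c < c'` only `bar c` can exceed an end of the other
chord, and it exceeds exactly one of them when the chords cross. -/
lemma prod_pair_lowerDarts (hbar : Function.Involutive bar) {C : Finset D}
    (hC : C ⊆ lowerDarts bar) :
    ((∏ c ∈ C, pair c (bar c) : GrassmannCenter D) : ExteriorAlgebra ℂ (D → ℂ)) =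
      (-1 : ℂ) ^ crossings bar C • monomial (orbitSupport bar C) := by
  induction C using Finset.induction_on_min with
  | empty => simp [orbitSupport, crossings, monomial_empty]
  | insert c C hc ih =>
    obtain ⟨h1, h2⟩ := Finset.insert_subset_iff.1 hC
    have hcC : c ∉ C := fun h => lt_irrefl _ (hc c h)
    have hpair : ((pair c (bar c) : GrassmannCenter D) : ExteriorAlgebra ℂ (D → ℂ)) =
        monomial {c, bar c} := by
      rw [monomial_insert_of_lt, monomial_singleton]
      · rfl
      · simpa [lowerDarts] using h1
    have hcr : crossings bar (insert c C) =
        crossings bar C + inversions {c, bar c} (orbitSupport bar C) := by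
      rw [inversions_orbitSupport_right hbar _ h2, crossings, Finset.sum_insert hcC, add_comm,
        Finset.filter_insert, if_neg (lt_irrefl c), Finset.filter_true_of_mem hc, crossings]
      congr 1
      refine Finset.sum_congr rfl fun c' hc' => ?_
      rw [Finset.filter_insert, if_neg (hc c' hc').le.not_gt]
    rw [Finset.prod_insert hcC, Subalgebra.coe_mul, ih h2, hpair, mul_smul_comm,
      monomial_mul_monomial (disjoint_orbitSupport hbar h1 h2 hcC), smul_smul, ← pow_add,
      orbitSupport_insert, hcr]

variable {V : Type*} [Fintype V] [LinearOrder V] {vert : D → V}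

/-- The expansion of the Pfaffian of a matrix that is all-ones above the diagonal inside the
blocks, and is otherwise supported on the orbits of the involution `bar`. -/
theorem pfaffian_expansion {n : ℕ} (enum : Fin (2 * n) ≃o D) (hvert : Monotone vert)
    (hbar : Function.Involutive bar) (hbar' : ∀ d, vert (bar d) ≠ vert d) (A : Matrix D D ℂ)
    (hA : A.transpose = -A) (hblock : ∀ a b, a < b → vert a = vert b → A a b = 1)
    (hzero : ∀ a b, vert a ≠ vert b → b ≠ bar a → A a b = 0) :
    pfaffian (A.submatrix enum enum) =
      ∑ C ∈ (lowerDarts bar).powerset with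
          ∀ v, Even #{x ∈ orbitCompl bar C | vert x = v},
        (-1) ^ (crossings bar C + inversions (orbitSupport bar C) (orbitCompl bar C)) *
          ∏ c ∈ C, A c (bar c) := by
  -- A factor differs from `1` only for a pair at one vertex or a pair `(c, bar c)`, and these two
  -- kinds are disjoint.
  have hprod : ∏ p : D × D with p.1 < p.2, (1 + A p.1 p.2 • pair p.1 p.2) =
      (∏ c ∈ lowerDarts bar, (1 + A c (bar c) • pair c (bar c))) *
        ∏ p : D × D with p.1 < p.2 ∧ vert p.1 = vert p.2 ∧ vert p.1 ∈ univ,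
          (1 + pair p.1 p.2) := by
    rw [← Finset.prod_filter_mul_prod_filter_not ({p : D × D | p.1 < p.2} : Finset (D × D))
      (fun p => vert p.1 = vert p.2), mul_comm]
    congr 1
    · rw [← Finset.prod_image (s := lowerDarts bar) (g := fun c => (c, bar c))
        (f := fun p : D × D => 1 + A p.1 p.2 • pair p.1 p.2)]
      · symm
        refine Finset.prod_subset ?_ ?_
        · rintro ⟨a, b⟩ h
          simp only [lowerDarts, mem_image, mem_filter, mem_univ, true_and, Prod.mk.injEq] at h ⊢
          obtain ⟨c, hc, rfl, rfl⟩ := h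
          exact ⟨hc, (hbar' c).symm⟩
        · rintro ⟨a, b⟩ h h'
          simp only [lowerDarts, mem_image, mem_filter, mem_univ, true_and, Prod.mk.injEq,
            not_exists, not_and] at h h'
          rw [hzero a b h.2, zero_smul, add_zero]
          rintro rfl
          exact h' a h.1 rfl rfl
      · exact fun a _ b _ h => (Prod.mk.inj h).1
    · rw [Finset.filter_filter]
      refine Finset.prod_congr (by simp) fun p hp => ?_
      simp only [mem_filter, mem_univ, true_and, and_true] at hp
      rw [hblock _ _ hp.1 hp.2, one_smul]
  rw [show pfaffian (A.submatrix enum enum) = _ from pfaffian_eq_berezin enum.toEquiv A hA,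
    hprod, Subalgebra.coe_mul,
    prod_one_add_pair_blocks hvert, Finset.prod_one_add, ← Subalgebra.coe_val, map_sum,
    Finset.sum_mul, map_sum]
  conv_rhs => rw [Finset.sum_filter]
  refine Finset.sum_congr rfl fun C hC => ?_
  have hC := Finset.mem_powerset.1 hC
  rw [Finset.prod_smul, map_smul, Subalgebra.coe_val, prod_pair_lowerDarts hbar hC,
    Finset.mul_sum, map_sum]
  simp only [smul_mul_assoc, map_smul]
  -- The chord monomial of `C` reaches top degree only together with the monomial of the
  -- complementary darts.
  have hterm (S : Finset D) :
      berezin enum.toEquiv (monomial (orbitSupport bar C) * monomial S) =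
        if S = orbitCompl bar C then
          (-1) ^ inversions (orbitSupport bar C) (orbitCompl bar C) else 0 := by
    by_cases hd : Disjoint (orbitSupport bar C) S
    · rw [monomial_mul_monomial hd, map_smul, berezin_monomial]
      have : orbitSupport bar C ∪ S = univ ↔ S = orbitCompl bar C := by
        rw [orbitCompl, eq_compl_iff_isCompl, isCompl_comm, isCompl_iff, codisjoint_iff]
        exact ⟨fun h => ⟨hd, h⟩, fun h => h.2⟩
      by_cases hS : S = orbitCompl bar C
      · rw [if_pos (this.2 hS), if_pos hS, hS, smul_eq_mul, mul_one]
      · rw [if_neg (this.not.2 hS), if_neg hS, smul_zero]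
    · rw [monomial_mul_monomial_of_not_disjoint hd, map_zero, if_neg]
      rintro rfl
      exact hd disjoint_compl_right
  simp only [hterm, mem_univ, implies_true, true_and, smul_eq_mul, mul_ite, mul_zero]
  rw [Finset.sum_ite_eq']
  simp only [mem_filter, mem_univ, true_and, pow_add]
  split_ifs
  · ring
  · rfl

end PfaffianExpansion

/-! ### Euler's relation: cycles modulo 2 are boundaries of faces -/

section CycleSpace

variable {V : Type*} [Fintype V] [DecidableEq V] (G : SimpleGraph V) [DecidableRel G.Adj]

/-- The boundary map modulo `2`, from edges to vertices. -/
def edgeBoundary : (G.edgeSet → ZMod 2) →ₗ[ZMod 2] (V → ZMod 2) where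
  toFun x v := ∑ d : G.Dart with d.fst = v, x ⟨d.edge, d.edge_mem⟩
  map_add' x y := by
    funext v
    simp [Finset.sum_add_distrib]
  map_smul' c x := by
    funext v
    simp [Finset.mul_sum]

/-- A dart on a given edge. -/
def edgeDart (e : G.edgeSet) : G.Dart :=
  ⟨(Quot.out e.1), by
    have h := e.2
    rw [← Quot.out_eq e.1] at h
    exact h⟩

lemma edge_edgeDart (e : G.edgeSet) : (edgeDart G e).edge = e := Quot.out_eq e.1

variable {G}

/-- The face of a rotation system that contains a dart. -/
def RotationSystem.face (ρ : RotationSystem G) (d : G.Dart) :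
    Quotient (Equiv.Perm.SameCycle.setoid ρ.facePerm) := Quotient.mk _ d

lemma RotationSystem.face_next (ρ : RotationSystem G) (d : G.Dart) :
    ρ.face (ρ.next d) = ρ.face d.symm := by
  symm
  apply Quotient.sound
  refine ⟨1, ?_⟩
  simp [RotationSystem.facePerm, dartSymm]

/-- The boundary map modulo `2`, from faces to edges. -/
def RotationSystem.faceBoundary (ρ : RotationSystem G) :
    (Quotient (Equiv.Perm.SameCycle.setoid ρ.facePerm) → ZMod 2) →ₗ[ZMod 2]
      (G.edgeSet → ZMod 2) where
  toFun h e := h (ρ.face (edgeDart G e)) + h (ρ.face (edgeDart G e).symm)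
  map_add' x y := by
    funext v
    simp only [Pi.add_apply]
    ring
  map_smul' c x := by
    funext v
    simp only [Pi.smul_apply, smul_eq_mul, RingHom.id_apply]
    ring

lemma RotationSystem.faceBoundary_dart (ρ : RotationSystem G)
    (h : Quotient (Equiv.Perm.SameCycle.setoid ρ.facePerm) → ZMod 2) (d : G.Dart) :
    ρ.faceBoundary h ⟨d.edge, d.edge_mem⟩ = h (ρ.face d) + h (ρ.face d.symm) := by
  rcases SimpleGraph.dart_edge_eq_iff _ _ |>.1 (edge_edgeDart G ⟨d.edge, d.edge_mem⟩) with hd | hd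
  · simp [RotationSystem.faceBoundary, hd]
  · simp [RotationSystem.faceBoundary, hd, add_comm]

/-- By `face_next` the far side of `d` is the face of `ρ.next d`. Since `ρ.next` permutes the darts
at a vertex, every face value is counted twice there. -/
lemma edgeBoundary_faceBoundary (ρ : RotationSystem G)
    (h : Quotient (Equiv.Perm.SameCycle.setoid ρ.facePerm) → ZMod 2) :
    edgeBoundary G (ρ.faceBoundary h) = 0 := by
  funext v
  change ∑ d : G.Dart with d.fst = v, ρ.faceBoundary h ⟨d.edge, d.edge_mem⟩ = 0
  simp only [ρ.faceBoundary_dart, ← ρ.face_next, Finset.sum_add_distrib]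
  have : ∑ d : G.Dart with d.fst = v, h (ρ.face (ρ.next d)) =
      ∑ d : G.Dart with d.fst = v, h (ρ.face d) :=
    Finset.sum_bijective ρ.next ρ.next.bijective (by simp [ρ.fst_next]) (fun _ _ => rfl)
  rw [this, CharTwo.add_self_eq_zero]

lemma edgeBoundary_single (d : G.Dart) :
    edgeBoundary G (Pi.single ⟨d.edge, d.edge_mem⟩ 1) = Pi.single d.fst 1 + Pi.single d.snd 1 := by
  funext v
  change ∑ d' : G.Dart with d'.fst = v,
    (Pi.single ⟨d.edge, d.edge_mem⟩ 1 : G.edgeSet → ZMod 2) ⟨d'.edge, d'.edge_mem⟩ = _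
  rw [Finset.sum_filter, ← Finset.sum_subset (Finset.subset_univ {d, d.symm}),
    Finset.sum_pair d.symm_ne.symm]
  · simp [Pi.single_apply, eq_comm]
  · intro d' _ hd'
    have : (⟨d'.edge, d'.edge_mem⟩ : G.edgeSet) ≠ ⟨d.edge, d.edge_mem⟩ := by
      simp only [ne_eq, Subtype.mk.injEq, SimpleGraph.dart_edge_eq_iff]
      simpa using hd'
    rw [Pi.single_eq_of_ne this, ite_self]

/-- Modulo the range all vertices of a connected graph become equal, so one vertex together with the
range spans everything. -/
lemma card_le_finrank_range_edgeBoundary (hG : G.Connected) :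
    Fintype.card V ≤ Module.finrank (ZMod 2) (edgeBoundary G).range + 1 := by
  obtain ⟨v₀⟩ := hG.nonempty
  set W := (edgeBoundary G).range ⊔ Submodule.span (ZMod 2) {Pi.single v₀ 1} with hW
  have hstep {u v : V} (huv : G.Adj u v) (hu : (Pi.single u 1 : V → ZMod 2) ∈ W) :
      (Pi.single v 1 : V → ZMod 2) ∈ W := by
    have h : (Pi.single u 1 + Pi.single v 1 : V → ZMod 2) ∈ W :=
      Submodule.mem_sup_left ⟨_, edgeBoundary_single ⟨(u, v), huv⟩⟩
    simpa using W.sub_mem h hu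
  have hwalk {u v : V} (p : G.Walk u v) (hu : (Pi.single u 1 : V → ZMod 2) ∈ W) :
      (Pi.single v 1 : V → ZMod 2) ∈ W := by
    induction p with
    | nil => exact hu
    | cons huv p ih => exact ih (hstep huv hu)
  have hall (v : V) : (Pi.single v 1 : V → ZMod 2) ∈ W := by
    obtain ⟨p⟩ := hG.preconnected v₀ v
    exact hwalk p (Submodule.mem_sup_right (Submodule.mem_span_singleton_self _))
  have htop : W = ⊤ := by
    rw [eq_top_iff, ← (Pi.basisFun (ZMod 2) V).span_eq, Submodule.span_le]
    rintro _ ⟨v, rfl⟩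
    simpa using hall v
  calc Fintype.card V = Module.finrank (ZMod 2) W := by
        rw [htop, finrank_top, Module.finrank_fintype_fun_eq_card]
    _ ≤ _ := Submodule.finrank_add_le_finrank_add_finrank _ _
    _ ≤ _ := Nat.add_le_add_left (by
      simpa using finrank_span_le_card (R := ZMod 2) ({Pi.single v₀ 1} : Set (V → ZMod 2))) _

/-- A function in the kernel agrees on the two sides of every edge, hence around every vertex and
along every walk, so it is constant. -/
lemma RotationSystem.finrank_ker_faceBoundary_le (ρ : RotationSystem G) (hG : G.Connected) :
    Module.finrank (ZMod 2) ρ.faceBoundary.ker ≤ 1 := by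
  have hker (h) (hh : ρ.faceBoundary h = 0) (d d' : G.Dart) : h (ρ.face d) = h (ρ.face d') := by
    have hsymm (d : G.Dart) : h (ρ.face d.symm) = h (ρ.face d) := by
      have := ρ.faceBoundary_dart h d
      rw [hh] at this
      exact (CharTwo.add_eq_zero.1 this.symm).symm
    have hnext (d : G.Dart) : h (ρ.face (ρ.next d)) = h (ρ.face d) := by
      rw [ρ.face_next, hsymm]
    have hvert {d d' : G.Dart} (hdd : d.fst = d'.fst) : h (ρ.face d) = h (ρ.face d') := by
      obtain ⟨k, rfl⟩ := (ρ.sameCycle d d' hdd).exists_nat_pow_eq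
      clear hdd
      induction k with
      | zero => rfl
      | succ k ih => rw [ih, pow_succ', Equiv.Perm.mul_apply, hnext]
    have hwalk {u v : V} (p : G.Walk u v) (d d' : G.Dart) (hd : d.fst = u) (hd' : d'.fst = v) :
        h (ρ.face d) = h (ρ.face d') := by
      induction p generalizing d with
      | nil => exact hvert (hd.trans hd'.symm)
      | cons huv p ih =>
        rw [hvert (d' := ⟨(_, _), huv⟩) hd, ← hsymm]
        exact ih _ rfl hd'
    obtain ⟨p⟩ := hG.preconnected d.fst d'.fst
    exact hwalk p d d' rfl rfl
  have hone : ρ.faceBoundary 1 = 0 := by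
    funext e
    exact CharTwo.add_self_eq_zero 1
  refine finrank_le_one ⟨1, hone⟩ ?_
  rintro ⟨h, hh⟩
  by_cases hd : Nonempty G.Dart
  · obtain ⟨d₀⟩ := hd
    refine ⟨h (ρ.face d₀), Subtype.ext ?_⟩
    funext q
    induction q using Quotient.inductionOn with
    | h d => exact (mul_one _).trans (hker h hh d₀ d)
  · refine ⟨0, Subtype.ext ?_⟩
    funext q
    induction q using Quotient.inductionOn with
    | h d => exact absurd ⟨d⟩ hd

/-- The cycle space has dimension at most `E - V + 1`, and the face boundaries inside it have
dimension at least `F - 1`. The hypothesis `hcard` makes the lower bound at least the upper one. -/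
theorem RotationSystem.exists_faceBoundary_eq (ρ : RotationSystem G) (hG : G.Connected)
    (hcard : Nat.card G.edgeSet + 2 ≤ Nat.card V +
      Nat.card (Quotient (Equiv.Perm.SameCycle.setoid ρ.facePerm)))
    (y : G.edgeSet → ZMod 2) (hy : edgeBoundary G y = 0) : ∃ h, ρ.faceBoundary h = y := by
  have h1 := card_le_finrank_range_edgeBoundary hG
  have h2 := ρ.finrank_ker_faceBoundary_le hG
  have h3 := (edgeBoundary G).finrank_range_add_finrank_ker
  have h4 := ρ.faceBoundary.finrank_range_add_finrank_ker
  have : Fintype (Quotient (Equiv.Perm.SameCycle.setoid ρ.facePerm)) := Fintype.ofFinite _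
  rw [Module.finrank_fintype_fun_eq_card, ← Nat.card_eq_fintype_card] at h3 h4
  rw [← Nat.card_eq_fintype_card] at h1
  have hle : ρ.faceBoundary.range ≤ (edgeBoundary G).ker := by
    rintro _ ⟨h, rfl⟩
    exact edgeBoundary_faceBoundary ρ h
  have heq := Submodule.eq_of_le_of_finrank_le hle (by omega)
  have : y ∈ ρ.faceBoundary.range := heq ▸ hy
  exact this

end CycleSpace

/-! ### The crossing form and its linearity on cycles -/

section PolarForm

variable {D : Type*} [Fintype D] [LinearOrder D] {bar : D → D}

lemma sum_eq_sum_lowerDarts {M : Type*} [AddCommMonoid M] (hbar : Function.Involutive bar)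
    (hbar' : ∀ d, bar d ≠ d) (f : D → M) :
    ∑ d, f d = ∑ c ∈ lowerDarts bar, (f c + f (bar c)) := by
  rw [Finset.sum_add_distrib, ← Finset.sum_filter_add_sum_filter_not univ (fun d => d < bar d)]
  congr 1
  refine Finset.sum_nbij' bar bar ?_ ?_ (fun d _ => hbar d) (fun d _ => hbar d)
    (fun d _ => by rw [hbar d])
  · intro d hd
    simp only [mem_filter, mem_univ, true_and, not_lt, lowerDarts, hbar d] at hd ⊢
    exact lt_of_le_of_ne hd (hbar' d)
  · intro d hd
    simp only [mem_filter, mem_univ, true_and, not_lt, lowerDarts, hbar d] at hd ⊢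
    exact hd.le

lemma inversions_cast (S T : Finset D) :
    (inversions S T : ZMod 2) = ∑ a ∈ S, ∑ b ∈ T, if b < a then 1 else 0 := by
  simp [inversions]

lemma inversions_add_inversions {S T : Finset D} (h : Disjoint S T) :
    inversions S T + inversions T S = #S * #T := by
  have h1 : inversions T S = ∑ a ∈ S, #{b ∈ T | a < b} := by
    simp only [inversions, Finset.card_filter]
    exact Finset.sum_comm
  rw [h1, inversions, ← Finset.sum_add_distrib, ← smul_eq_mul, ← Finset.sum_const]
  refine Finset.sum_congr rfl fun a ha => ?_
  rw [← Finset.card_filter_add_card_filter_not (s := T) (fun b => b < a)]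
  congr 2
  refine Finset.filter_congr fun b hb => ?_
  rw [not_lt]
  exact ⟨le_of_lt, fun hab => lt_of_le_of_ne hab fun e => Finset.disjoint_left.1 h ha (e ▸ hb)⟩

lemma inversions_chord_self {c : D} (hc : c ∈ lowerDarts bar) :
    inversions {c, bar c} {c, bar c} = 1 := by
  have hlt : c < bar c := by simpa [lowerDarts] using hc
  simp [inversions, Finset.sum_pair hlt.ne, Finset.filter_insert, Finset.filter_singleton, hlt,
    hlt.le.not_gt]

/-- The inversions in the two directions add up to the number `2 * 2` of pairs, which is even. -/
lemma inversions_chord_comm (hbar : Function.Involutive bar) {c c' : D}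
    (hc : c ∈ lowerDarts bar) (hc' : c' ∈ lowerDarts bar) (hne : c ≠ c') :
    (inversions {c, bar c} {c', bar c'} : ZMod 2) = inversions {c', bar c'} {c, bar c} := by
  have hd := disjoint_orbitSupport (C := {c'}) hbar hc (by simpa using hc') (by simpa using hne)
  have h := inversions_add_inversions hd
  have hlt' : c' < bar c' := by simpa [lowerDarts] using hc'
  have hlt : c < bar c := by simpa [lowerDarts] using hc
  have hs : orbitSupport bar {c'} = {c', bar c'} := by ext; simp [orbitSupport]
  rw [hs, Finset.card_pair hlt.ne, Finset.card_pair hlt'.ne] at h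
  rw [← CharTwo.add_eq_zero, ← Nat.cast_add, h]
  rfl

variable (bar) in
/-- The quadratic form modulo `2` that counts the crossings of chords. -/
def crossingForm (x : D → ZMod 2) : ZMod 2 :=
  ∑ c ∈ lowerDarts bar, ∑ c' ∈ lowerDarts bar with c < c',
    inversions {c, bar c} {c', bar c'} * (x c * x c')

/-- The bilinear form modulo `2` that counts the pairs in decreasing order. -/
def inversionForm (x y : D → ZMod 2) : ZMod 2 := ∑ d, ∑ d', if d' < d then x d * y d' else 0

lemma inversionForm_eq (hbar : Function.Involutive bar) (hbar' : ∀ d, bar d ≠ d)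
    {x y : D → ZMod 2} (hx : ∀ d, x (bar d) = x d) (hy : ∀ d, y (bar d) = y d) :
    inversionForm x y = ∑ c ∈ lowerDarts bar, ∑ c' ∈ lowerDarts bar,
      inversions {c, bar c} {c', bar c'} * (x c * y c') := by
  rw [inversionForm, sum_eq_sum_lowerDarts hbar hbar']
  refine Finset.sum_congr rfl fun c hc => ?_
  rw [sum_eq_sum_lowerDarts hbar hbar', sum_eq_sum_lowerDarts hbar hbar', ← Finset.sum_add_distrib]
  refine Finset.sum_congr rfl fun c' hc' => ?_
  rw [inversions_cast, Finset.sum_pair (hbar' c).symm, Finset.sum_pair (hbar' c').symm,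
    Finset.sum_pair (hbar' c').symm, hx, hy]
  simp only [add_mul, ite_mul, one_mul, zero_mul]

/-- The inversion form runs over all ordered pairs of chords. By symmetry of chord inversions, its
off-diagonal part is the cross term of the quadratic form; its diagonal part has coefficient `1` and
is cancelled by the added sum. -/
lemma crossingForm_add (hbar : Function.Involutive bar) (hbar' : ∀ d, bar d ≠ d)
    {x y : D → ZMod 2} (hx : ∀ d, x (bar d) = x d) (hy : ∀ d, y (bar d) = y d) :
    crossingForm bar (x + y) = crossingForm bar x + crossingForm bar y +
      (inversionForm x y + ∑ c ∈ lowerDarts bar, x c * y c) := by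
  set L := lowerDarts bar
  have htri : inversionForm x y = ∑ c ∈ L, ∑ c' ∈ L with c < c',
      (inversions {c, bar c} {c', bar c'} : ZMod 2) * (x c * y c') +
      (∑ c ∈ L, x c * y c +
        ∑ c ∈ L, ∑ c' ∈ L with c < c',
          (inversions {c, bar c} {c', bar c'} : ZMod 2) * (y c * x c')) := by
    have hswap : ∑ c ∈ L, ∑ c' ∈ L with c < c',
          (inversions {c, bar c} {c', bar c'} : ZMod 2) * (y c * x c') =
        ∑ c ∈ L, ∑ c' ∈ L with c' < c,
          (inversions {c, bar c} {c', bar c'} : ZMod 2) * (x c * y c') := by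
      simp only [Finset.sum_filter]
      rw [Finset.sum_comm]
      refine Finset.sum_congr rfl fun c hc => Finset.sum_congr rfl fun c' hc' => ?_
      split_ifs with h
      · rw [inversions_chord_comm hbar hc' hc h.ne]
        ring
      · rfl
    rw [hswap, inversionForm_eq hbar hbar' hx hy, ← Finset.sum_add_distrib,
      ← Finset.sum_add_distrib]
    refine Finset.sum_congr rfl fun c hc => ?_
    rw [← Finset.sum_filter_add_sum_filter_not L (fun c' => c < c')]
    congr 1
    have hcL : c ∈ ({c' ∈ L | ¬ c < c'} : Finset D) := by simpa using hc
    rw [← Finset.add_sum_erase ({c' ∈ L | ¬ c < c'} : Finset D)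
      (fun c' => (inversions {c, bar c} {c', bar c'} : ZMod 2) * (x c * y c')) hcL,
      inversions_chord_self hc, Nat.cast_one, one_mul]
    have herase : ({c' ∈ L | ¬ c < c'} : Finset D).erase c = {c' ∈ L | c' < c} := by
      ext c'
      simp only [mem_erase, mem_filter, not_lt, ne_eq]
      constructor
      · exact fun h => ⟨h.2.1, lt_of_le_of_ne h.2.2 h.1⟩
      · exact fun h => ⟨h.2.ne, h.1, h.2.le⟩
    rw [herase]
  have hexp : crossingForm bar (x + y) = crossingForm bar x + crossingForm bar y +
      (∑ c ∈ L, ∑ c' ∈ L with c < c',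
        (inversions {c, bar c} {c', bar c'} : ZMod 2) * (x c * y c') +
      ∑ c ∈ L, ∑ c' ∈ L with c < c',
        (inversions {c, bar c} {c', bar c'} : ZMod 2) * (y c * x c')) := by
    simp only [crossingForm, Pi.add_apply]
    rw [← Finset.sum_add_distrib, ← Finset.sum_add_distrib, ← Finset.sum_add_distrib]
    refine Finset.sum_congr rfl fun c _ => ?_
    rw [← Finset.sum_add_distrib, ← Finset.sum_add_distrib, ← Finset.sum_add_distrib]
    refine Finset.sum_congr rfl fun c' _ => ?_
    ring
  rw [hexp, htri]
  linear_combination -CharTwo.add_self_eq_zero (∑ c ∈ L, x c * y c)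

variable {V : Type*} [Fintype V] [LinearOrder V]

/-- In terms of the positions of the darts around the vertices, the inversion form of a vector
and a cycle is a sum of local terms. -/
lemma inversionForm_eq_local (slot : V × Fin 4 ≃ D)
    (hslot : ∀ v i u j, slot (v, i) < slot (u, j) ↔ v < u ∨ v = u ∧ i < j)
    (x : D → ZMod 2) {y : D → ZMod 2} (hy : ∀ v, ∑ i, y (slot (v, i)) = 0) :
    inversionForm x y =
      ∑ v, ∑ i, ∑ j, if j < i then x (slot (v, i)) * y (slot (v, j)) else 0 := by
  rw [inversionForm, ← slot.sum_comp, Fintype.sum_prod_type]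
  refine Finset.sum_congr rfl fun v _ => Finset.sum_congr rfl fun i _ => ?_
  rw [← slot.sum_comp, Fintype.sum_prod_type, Fintype.sum_eq_single v]
  · simp [hslot]
  -- For a lower vertex `u` all four darts precede the given one, so the vanishing sum of `y` at `u`
  -- appears as a factor.
  · intro u hu
    by_cases h : u < v
    · simp only [hslot, h, true_or, if_true, ← Finset.mul_sum, hy u, mul_zero]
    · simp [hslot, h, hu]

/-- The polar form of the crossing form vanishes at a boundary of faces and a cycle. -/
lemma inversionForm_boundary (hbar : Function.Involutive bar) (hbar' : ∀ d, bar d ≠ d)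
    (slot : V × Fin 4 ≃ D)
    (hslot : ∀ v i u j, slot (v, i) < slot (u, j) ↔ v < u ∨ v = u ∧ i < j)
    (g : D → ZMod 2) (hg : ∀ v i, g (bar (slot (v, i))) = g (slot (v, i + 1)))
    {y : D → ZMod 2} (hy' : ∀ d, y (bar d) = y d) (hy : ∀ v, ∑ i, y (slot (v, i)) = 0) :
    inversionForm (fun d => g d + g (bar d)) y +
      ∑ c ∈ lowerDarts bar, (g c + g (bar c)) * y c = 0 := by
  rw [CharTwo.add_eq_zero, inversionForm_eq_local slot hslot _ hy]
  have h : ∑ c ∈ lowerDarts bar, (g c + g (bar c)) * y c = ∑ d, y d * g (bar d) := by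
    rw [sum_eq_sum_lowerDarts hbar hbar']
    refine Finset.sum_congr rfl fun c _ => ?_
    rw [hbar c, hy']
    ring
  rw [h, ← slot.sum_comp, Fintype.sum_prod_type]
  refine Finset.sum_congr rfl fun v _ => ?_
  have hv := hy v
  have h2 : (2 : ZMod 2) = 0 := rfl
  simp only [hg, Fin.sum_univ_four] at hv ⊢
  simp only [show ((0 : Fin 4) + 1) = 1 from rfl, show ((1 : Fin 4) + 1) = 2 from rfl,
    show ((2 : Fin 4) + 1) = 3 from rfl, show ((3 : Fin 4) + 1) = 0 from rfl]
  simp only [show ¬ ((0 : Fin 4) < 0) by decide, show ((0 : Fin 4) < 1) by decide,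
    show ((0 : Fin 4) < 2) by decide, show ((0 : Fin 4) < 3) by decide,
    show ¬ ((1 : Fin 4) < 0) by decide, show ¬ ((1 : Fin 4) < 1) by decide,
    show ((1 : Fin 4) < 2) by decide, show ((1 : Fin 4) < 3) by decide,
    show ¬ ((2 : Fin 4) < 0) by decide, show ¬ ((2 : Fin 4) < 1) by decide,
    show ¬ ((2 : Fin 4) < 2) by decide, show ((2 : Fin 4) < 3) by decide,
    show ¬ ((3 : Fin 4) < 0) by decide, show ¬ ((3 : Fin 4) < 1) by decide,
    show ¬ ((3 : Fin 4) < 2) by decide, show ¬ ((3 : Fin 4) < 3) by decide, if_true, if_false]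
  generalize g (slot (v, 0)) = g0, g (slot (v, 1)) = g1, g (slot (v, 2)) = g2,
    g (slot (v, 3)) = g3, y (slot (v, 0)) = y0, y (slot (v, 1)) = y1, y (slot (v, 2)) = y2,
    y (slot (v, 3)) = y3 at *
  -- Here `x` is `g i + g (i + 1)` at position `i`, so the sum over `i > j` telescopes to `g (j + 1)
  -- + g 0`. The `g 0` part is removed by the cycle condition `hv`, leaving the far-side value `g (j
  -- + 1)`.
  linear_combination g0 * hv + (y0 * g2 + y0 * g3 + y1 * g3 - y3 * g0) * h2

/-- If every cycle is a boundary of faces, then the crossing form is linear on cycles. -/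
theorem exists_crossingForm_eq_sum (hbar : Function.Involutive bar) (hbar' : ∀ d, bar d ≠ d)
    (slot : V × Fin 4 ≃ D)
    (hslot : ∀ v i u j, slot (v, i) < slot (u, j) ↔ v < u ∨ v = u ∧ i < j)
    (hface : ∀ x : D → ZMod 2, (∀ d, x (bar d) = x d) → (∀ v, ∑ i, x (slot (v, i)) = 0) →
      ∃ g : D → ZMod 2, (∀ v i, g (bar (slot (v, i))) = g (slot (v, i + 1))) ∧
        ∀ d, x d = g d + g (bar d)) :
    ∃ ε : D → ZMod 2, ∀ x : D → ZMod 2, (∀ d, x (bar d) = x d) →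
      (∀ v, ∑ i, x (slot (v, i)) = 0) →
      crossingForm bar x = ∑ c ∈ lowerDarts bar, ε c * x c := by
  let K : Submodule (ZMod 2) (D → ZMod 2) :=
    { carrier := {x | (∀ d, x (bar d) = x d) ∧ ∀ v, ∑ i, x (slot (v, i)) = 0}
      add_mem' := fun {x y} hx hy => ⟨fun d => by simp [hx.1, hy.1], fun v => by
        simp [Finset.sum_add_distrib, hx.2, hy.2]⟩
      zero_mem' := by simp
      smul_mem' := fun a x hx => ⟨fun d => by simp [hx.1], fun v => by
        simp [← Finset.mul_sum, hx.2]⟩ }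
  let q : K →+ ZMod 2 := AddMonoidHom.mk' (fun x => crossingForm bar x.1) fun x y => by
    obtain ⟨g, hg, hx⟩ := hface x.1 x.2.1 x.2.2
    have hx' : x.1 = fun d => g d + g (bar d) := funext hx
    have h := inversionForm_boundary hbar hbar' slot hslot g hg y.2.1 y.2.2
    rw [← hx'] at h
    simp only [← hx] at h
    rw [Submodule.coe_add, crossingForm_add hbar hbar' x.2.1 y.2.1, h, add_zero]
  -- Additivity over `ZMod 2` is linearity, and a functional on the subspace of cycles extends to
  -- all dart vectors.
  obtain ⟨ℓ, hℓ⟩ := LinearMap.exists_extend (AddMonoidHom.toZModLinearMap 2 q)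
  -- A chord gets the values of `ℓ` at both of its ends, because cycle vectors take the same value
  -- there.
  refine ⟨fun d => ℓ (Pi.single d 1) + ℓ (Pi.single (bar d) 1), fun x hx hx' => ?_⟩
  have h1 : crossingForm bar x = ℓ x := (LinearMap.congr_fun hℓ ⟨x, hx, hx'⟩).symm
  rw [h1]
  conv_lhs => rw [← Finset.univ_sum_single x]
  rw [map_sum, sum_eq_sum_lowerDarts hbar hbar']
  refine Finset.sum_congr rfl fun c _ => ?_
  have hs (d : D) : ℓ (Pi.single d (x d)) = ℓ (Pi.single d 1) * x d := by
    rw [mul_comm, ← smul_eq_mul, ← map_smul, ← Pi.single_smul', smul_eq_mul, mul_one]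
  rw [hs, hs, hx, add_mul]

end PolarForm

/-! ### Dart positions, the reference matching and the sign matrix -/

section Slots

variable {V : Type*} [Fintype V] [DecidableEq V] {G : SimpleGraph V} [DecidableRel G.Adj]

lemma RotationSystem.minimalPeriod_next (ρ : RotationSystem G) (d : G.Dart) :
    Function.minimalPeriod ρ.next d = G.degree d.fst := by
  rw [← G.dart_fst_fiber_card_eq_degree d.fst, ← Finset.card_range (Function.minimalPeriod _ _)]
  have hpos : 0 < Function.minimalPeriod ρ.next d :=
    Function.minimalPeriod_pos_of_mem_periodicPts (ρ.next.injective.mem_periodicPts d)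
  refine Finset.card_bij (fun k _ => ρ.next^[k] d) ?_ ?_ ?_
  · intro k hk
    simp only [mem_filter, mem_univ, true_and]
    clear hk
    induction k with
    | zero => rfl
    | succ k ih => rw [Function.iterate_succ_apply', ρ.fst_next, ih]
  · intro i hi j hj hij
    exact Function.iterate_injOn_Iio_minimalPeriod (by simpa using hi) (by simpa using hj) hij
  · intro d' hd'
    simp only [mem_filter, mem_univ, true_and] at hd'
    obtain ⟨k, rfl⟩ := (ρ.sameCycle d d' hd'.symm).exists_nat_pow_eq
    refine ⟨k % Function.minimalPeriod ρ.next d, by simpa using Nat.mod_lt k hpos, ?_⟩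
    rw [Function.iterate_mod_minimalPeriod_eq, Equiv.Perm.iterate_eq_pow]

/-- The darts of a `4`-regular graph with a rotation system, numbered in the cyclic order around
each vertex. -/
lemma RotationSystem.exists_slot (ρ : RotationSystem G) (hreg : G.IsRegularOfDegree 4) {N : ℕ}
    (num : V ≃ Fin N) : ∃ slot : Fin N × Fin 4 ≃ G.Dart,
      (∀ v i, (slot (v, i)).fst = num.symm v) ∧
      ∀ v i, ρ.next (slot (v, i)) = slot (v, i + 1) := by
  have hbase (v : V) : ∃ d : G.Dart, d.fst = v := by
    have h : 0 < G.degree v := by rw [hreg v]; norm_num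
    rw [← G.dart_fst_fiber_card_eq_degree, Finset.card_pos] at h
    obtain ⟨d, hd⟩ := h
    exact ⟨d, by simpa using hd⟩
  choose b hb using hbase
  have hper (v : V) : Function.minimalPeriod ρ.next (b v) = 4 := by
    rw [ρ.minimalPeriod_next, hreg]
  have hfst (v : V) (k : ℕ) : (ρ.next^[k] (b v)).fst = v := by
    induction k with
    | zero => exact hb v
    | succ k ih => rw [Function.iterate_succ_apply', ρ.fst_next, ih]
  have hbij : Function.Bijective fun p : Fin N × Fin 4 => ρ.next^[p.2] (b (num.symm p.1)) := by
    constructor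
    · rintro ⟨v, i⟩ ⟨u, j⟩ h
      have hvu : v = u := by
        have := congrArg (fun d : G.Dart => d.fst) h
        simpa [hfst] using this
      subst hvu
      have := Function.iterate_injOn_Iio_minimalPeriod (f := ρ.next) (x := b (num.symm v))
        (by simp [hper]) (by simp [hper]) h
      exact congrArg (Prod.mk v) (Fin.ext this)
    · intro d
      obtain ⟨k, hk⟩ := (ρ.sameCycle (b d.fst) d (hb _)).exists_nat_pow_eq
      refine ⟨(num d.fst, ⟨k % 4, Nat.mod_lt _ (by norm_num)⟩), ?_⟩
      simp only [Equiv.symm_apply_apply]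
      rw [← hper d.fst, Function.iterate_mod_minimalPeriod_eq, Equiv.Perm.iterate_eq_pow, hk]
  refine ⟨Equiv.ofBijective _ hbij, fun v i => hfst _ _, fun v i => ?_⟩
  -- The addition `i + 1` in `Fin 4` wraps from `3` to `0`, which agrees with `ρ.next` because its
  -- period is `4`.
  simp only [Equiv.ofBijective_apply]
  have hmod := Function.iterate_mod_minimalPeriod_eq (f := ρ.next) (x := b (num.symm v))
    (n := i + 1)
  rw [hper] at hmod
  rw [← Function.iterate_succ_apply' ρ.next, Fin.val_add]
  exact hmod.symm

/-- In a connected graph with an embedding of genus zero, every cycle is a boundary of faces. -/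
lemma RotationSystem.exists_dart_potential (ρ : RotationSystem G) (hG : G.Connected)
    (hcard : Nat.card G.edgeSet + 2 ≤ Nat.card V +
      Nat.card (Quotient (Equiv.Perm.SameCycle.setoid ρ.facePerm)))
    (x : G.Dart → ZMod 2) (hx : ∀ d, x d.symm = x d)
    (hx' : ∀ v, ∑ d : G.Dart with d.fst = v, x d = 0) :
    ∃ g : G.Dart → ZMod 2, (∀ d, g d.symm = g (ρ.next d)) ∧ ∀ d, x d = g d + g d.symm := by
  have hdart (d : G.Dart) : x (edgeDart G ⟨d.edge, d.edge_mem⟩) = x d := by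
    rcases SimpleGraph.dart_edge_eq_iff _ _ |>.1 (edge_edgeDart G ⟨d.edge, d.edge_mem⟩) with h | h
    · rw [h]
    · rw [h, hx]
  obtain ⟨h, hh⟩ := ρ.exists_faceBoundary_eq hG hcard (fun e => x (edgeDart G e)) (by
    funext v
    change ∑ d : G.Dart with d.fst = v, x (edgeDart G ⟨d.edge, d.edge_mem⟩) = 0
    simpa only [hdart] using hx' v)
  refine ⟨fun d => h (ρ.face d), fun d => congrArg h (ρ.face_next d).symm, fun d => ?_⟩
  rw [← ρ.faceBoundary_dart, hh]
  exact (hdart d).symm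

/-- The matching of the dart graph that joins the darts at each vertex in pairs. -/
def slotMatching {N : ℕ} (num : V ≃ Fin N) (slot : Fin N × Fin 4 ≃ G.Dart)
    (hfst : ∀ v i, (slot (v, i)).fst = num.symm v) : (dartGraph G).Subgraph where
  verts := Set.univ
  -- The vector `![1, 0, 3, 2]` exchanges positions `0` and `1`, and positions `2` and `3`.
  Adj d d' := ∃ v i, d = slot (v, i) ∧ d' = slot (v, ![1, 0, 3, 2] i)
  adj_sub := by
    rintro _ _ ⟨v, i, rfl, rfl⟩
    refine ⟨fun h => ?_, Or.inl (by rw [hfst, hfst])⟩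
    have hi : ∀ i : Fin 4, i ≠ ![1, 0, 3, 2] i := by decide
    exact hi i (Prod.mk.inj (slot.injective h)).2
  edge_vert _ := Set.mem_univ _
  symm := ⟨by
    rintro _ _ ⟨v, i, rfl, rfl⟩
    refine ⟨v, ![1, 0, 3, 2] i, rfl, ?_⟩
    have hi : ∀ i : Fin 4, i = ![1, 0, 3, 2] (![1, 0, 3, 2] i) := by decide
    rw [← hi i]⟩

lemma slotMatching_isPerfectMatching {N : ℕ} (num : V ≃ Fin N) (slot : Fin N × Fin 4 ≃ G.Dart)
    (hfst : ∀ v i, (slot (v, i)).fst = num.symm v) :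
    (slotMatching num slot hfst).IsPerfectMatching := by
  refine ⟨fun d _ => ?_, fun d => Set.mem_univ d⟩
  obtain ⟨⟨v, i⟩, rfl⟩ := slot.surjective d
  refine ⟨_, ⟨v, i, rfl, rfl⟩, ?_⟩
  rintro _ ⟨u, j, h, rfl⟩
  obtain ⟨rfl, rfl⟩ := Prod.mk.inj (slot.injective h)
  rfl

lemma not_isEdgePair_of_slotMatching {N : ℕ} (num : V ≃ Fin N) (slot : Fin N × Fin 4 ≃ G.Dart)
    (hfst : ∀ v i, (slot (v, i)).fst = num.symm v) {d d' : G.Dart}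
    (h : (slotMatching num slot hfst).Adj d d') : ¬ IsEdgePair d d' := by
  obtain ⟨v, i, rfl, rfl⟩ := h
  exact fun h => h.1 (by rw [hfst, hfst])

/-- Every matched pair lies at a single vertex. This makes the prefactor `w(M₀ ∩ E)` an empty
product, and no weight is inverted. -/
lemma matchedEdges_slotMatching {N : ℕ} (num : V ≃ Fin N) (slot : Fin N × Fin 4 ≃ G.Dart)
    (hfst : ∀ v i, (slot (v, i)).fst = num.symm v) :
    matchedEdges G (slotMatching num slot hfst) = ∅ := by
  classical
  rw [matchedEdges, Finset.filter_eq_empty_iff]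
  rintro e _ ⟨d, d', hp, _, hadj⟩
  exact not_isEdgePair_of_slotMatching num slot hfst hadj hp

lemma fst_symm_ne (d : G.Dart) : d.symm.fst ≠ d.fst := d.adj.ne'

lemma isEdgePair_iff {d d' : G.Dart} : IsEdgePair d d' ↔ d' = d.symm := by
  rw [IsEdgePair, SimpleGraph.dart_edge_eq_iff]
  constructor
  · rintro ⟨h, rfl | rfl⟩
    · exact absurd rfl h
    · rw [SimpleGraph.Dart.symm_symm]
  · rintro rfl
    exact ⟨(fst_symm_ne d).symm, Or.inr d.symm_symm.symm⟩

variable [LinearOrder G.Dart]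

/-- The antisymmetric matrix that is all-ones above the diagonal at each vertex, and has the
entries `σ d` at the edges. -/
def signMatrix (σ : G.Dart → ℂ) : Matrix G.Dart G.Dart ℂ := Matrix.of fun a b =>
  if a.fst = b.fst then if a < b then 1 else if b < a then -1 else 0
  else if b = a.symm then if a < b then σ a else -σ b else 0

lemma signMatrix_antisymm (σ : G.Dart → ℂ) (a b : G.Dart) :
    signMatrix σ b a = -signMatrix σ a b := by
  simp only [signMatrix, Matrix.of_apply]
  by_cases h : a.fst = b.fst
  · rw [if_pos h, if_pos h.symm]
    rcases lt_trichotomy a b with h | rfl | h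
    · simp [h, h.le.not_gt]
    · simp
    · simp [h, h.le.not_gt]
  · rw [if_neg h, if_neg (Ne.symm h)]
    by_cases h' : b = a.symm
    · have h'' : a = b.symm := by rw [h', SimpleGraph.Dart.symm_symm]
      rw [if_pos h', if_pos h'']
      rcases lt_trichotomy a b with h1 | h1 | h1
      · simp [h1, h1.le.not_gt]
      · exact absurd (congrArg (fun d : G.Dart => d.fst) h1) h
      · simp [h1, h1.le.not_gt]
    · rw [if_neg h', if_neg, neg_zero]
      rintro rfl
      exact h' b.symm_symm.symm

lemma signMatrix_isIncidenceMatrix (σ : G.Dart → ℂ) : IsIncidenceMatrix G (signMatrix σ) where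
  antisymm := by
    ext a b
    exact signMatrix_antisymm σ a b
  eq_zero d d' h := by
    have h : d ≠ d' → ¬ (d.fst = d'.fst ∨ d.edge = d'.edge) := fun hne h' => h ⟨hne, h'⟩
    by_cases hdd : d = d'
    · subst hdd
      simp [signMatrix]
    · have h := h hdd
      push Not at h
      rw [signMatrix, Matrix.of_apply, if_neg h.1, if_neg]
      rintro rfl
      exact h.2 d.edge_symm.symm

lemma weightedMatrix_slotMatching {N : ℕ} (num : V ≃ Fin N) (slot : Fin N × Fin 4 ≃ G.Dart)
    (hfst : ∀ v i, (slot (v, i)).fst = num.symm v) (A : Matrix G.Dart G.Dart ℂ) (w : Sym2 V → ℝ)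
    (a b : G.Dart) :
    weightedMatrix (slotMatching num slot hfst) A w a b =
      if b = a.symm then w a.edge * A a b else A a b := by
  classical
  rw [weightedMatrix, Matrix.of_apply]
  simp only [← isEdgePair_iff]
  split_ifs with h1 h2
  · exact absurd h1 (not_isEdgePair_of_slotMatching num slot hfst h2)
  · rfl
  · rfl

end Slots

/-! ### Choice of the edge signs and comparison with the partition function -/

section Assembly

/-- The sign of a chord that compensates for its crossings if these are given by `ε`. -/
def chordSign {D : Type*} [Fintype D] [LinearOrder D] (bar : D → D) (ε : D → ZMod 2) (c : D) :
    ℂ :=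
  -- The three terms cancel the crossings, the inversions of the chord with all darts, and the
  -- single inversion of the chord with itself. The last is counted in `univ` but not in the
  -- complement of the support.
  (-1) ^ (ε c + inversions {c, bar c} univ + 1).val

/-- The chord signs compensate for all signs on a set of chords on which the crossing form is given
by `ε`. -/
lemma neg_one_pow_crossings {D : Type*} [Fintype D] [LinearOrder D] {bar : D → D}
    (hbar : Function.Involutive bar) {C : Finset D} (hC : C ⊆ lowerDarts bar) (ε : D → ZMod 2)
    (hε : crossingForm bar (fun d => if d ∈ orbitSupport bar C then 1 else 0) =
      ∑ c ∈ C, ε c) :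
    (-1 : ℂ) ^ (crossings bar C + inversions (orbitSupport bar C) (orbitCompl bar C)) *
      ∏ c ∈ C, chordSign bar ε c = 1 := by
  simp only [orbitCompl, chordSign]
  have hmem (c : D) (hc : c ∈ lowerDarts bar) : c ∈ orbitSupport bar C ↔ c ∈ C :=
    mem_orbitSupport_of_mem_lowerDarts hbar hc hC
  have hcross : (crossings bar C : ZMod 2) = ∑ c ∈ C, ε c := by
    have hC' : {c ∈ lowerDarts bar | c ∈ C} = C := by
      rw [Finset.filter_mem_eq_inter, Finset.inter_eq_right.2 hC]
    rw [← hε, crossingForm, crossings, Nat.cast_sum]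
    conv_lhs => rw [← hC', Finset.sum_filter]
    refine Finset.sum_congr rfl fun c hc => ?_
    simp only [hmem c hc]
    split_ifs with hcC
    · rw [Nat.cast_sum, hC']
      conv_lhs => rw [← hC']
      rw [Finset.filter_filter, Finset.sum_filter, Finset.sum_filter]
      refine Finset.sum_congr rfl fun c' hc' => ?_
      simp only [hmem c' hc']
      by_cases h1 : c' ∈ C <;> by_cases h2 : c < c' <;> simp [h1, h2]
    · simp
  -- Distinct chords contribute in symmetric pairs, which cancel modulo 2; each chord contributes
  -- `1` with itself.
  have hself : (inversions (orbitSupport bar C) (orbitSupport bar C) : ZMod 2) = #C := by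
    rw [inversions_orbitSupport_left hbar _ hC]
    simp only [inversions_orbitSupport_right hbar _ hC, Nat.cast_sum]
    have hdiag : (#C : ZMod 2) = ∑ c ∈ C, ∑ c' ∈ C, if c = c' then 1 else 0 := by
      simp
    rw [hdiag, ← sub_eq_zero, ← Finset.sum_sub_distrib]
    simp only [← Finset.sum_sub_distrib, ← Finset.sum_product']
    refine Finset.sum_involution (fun p _ => (p.2, p.1)) ?_ ?_ ?_ ?_
    · rintro ⟨c, c'⟩ hp
      simp only [mem_product] at hp
      rcases eq_or_ne c c' with rfl | hne
      · exact CharTwo.add_self_eq_zero _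
      · simp only [hne, hne.symm, if_false, sub_zero]
        rw [inversions_chord_comm hbar (hC hp.1) (hC hp.2) hne, CharTwo.add_self_eq_zero]
    · rintro ⟨c, c'⟩ hp hne heq
      simp only [mem_product] at hp
      obtain rfl : c' = c := (Prod.mk.inj heq).1
      rw [inversions_chord_self (hC hp.1)] at hne
      simp at hne
    · rintro ⟨c, c'⟩ hp
      simp only [mem_product] at hp ⊢
      exact hp.symm
    · rintro ⟨c, c'⟩ _
      rfl
  have hcompl : inversions (orbitSupport bar C) univ =
      inversions (orbitSupport bar C) (orbitSupport bar C) +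
        inversions (orbitSupport bar C) (orbitSupport bar C)ᶜ := by
    rw [← inversions_union_right disjoint_compl_right, Finset.union_compl]
  have huniv := inversions_orbitSupport_left hbar univ hC
  rw [Finset.prod_pow_eq_pow_sum, ← pow_add]
  apply Even.neg_one_pow
  rw [← ZMod.natCast_eq_zero_iff_even]
  push_cast
  simp only [ZMod.natCast_val, ZMod.cast_id', id_eq, Finset.sum_add_distrib, Finset.sum_const,
    nsmul_eq_mul, mul_one]
  rw [hcompl] at huniv
  have huniv' := congrArg (Nat.cast : ℕ → ZMod 2) huniv
  push_cast at huniv'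
  rw [← huniv', hself, hcross]
  have h2 : (2 : ZMod 2) = 0 := rfl
  linear_combination (∑ c ∈ C, ε c + (inversions (orbitSupport bar C) (orbitSupport bar C)ᶜ : ZMod 2)
    + #C) * h2

variable {V : Type*} [Fintype V] [DecidableEq V] {G : SimpleGraph V} [DecidableRel G.Adj]
  [LinearOrder G.Dart]

lemma mem_orbitSupport_symm {C : Finset G.Dart} {d : G.Dart} :
    d ∈ orbitSupport SimpleGraph.Dart.symm C ↔ d.edge ∈ C.image SimpleGraph.Dart.edge := by
  simp only [orbitSupport, mem_union, mem_image, SimpleGraph.dart_edge_eq_iff]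
  constructor
  · rintro (h | ⟨c, hc, rfl⟩)
    · exact ⟨d, h, Or.inl rfl⟩
    · exact ⟨c, hc, Or.inr c.symm_symm.symm⟩
  · rintro ⟨c, hc, rfl | rfl⟩
    · exact Or.inl hc
    · exact Or.inr ⟨_, hc, d.symm_symm⟩

lemma card_orbitSupport_fiber {C : Finset G.Dart} (v : V) :
    #{d ∈ orbitSupport SimpleGraph.Dart.symm C | d.fst = v} =
      #{e ∈ C.image SimpleGraph.Dart.edge | v ∈ e} := by
  refine Finset.card_bij (fun d _ => d.edge) ?_ ?_ ?_
  · intro d hd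
    rw [mem_filter, mem_orbitSupport_symm] at hd
    rw [mem_filter]
    exact ⟨hd.1, hd.2 ▸ Sym2.mem_mk_left _ _⟩
  · intro d hd d' hd' h
    rw [mem_filter] at hd hd'
    rcases SimpleGraph.dart_edge_eq_iff _ _ |>.1 h with h | rfl
    · exact h
    · exact absurd (hd.2.trans hd'.2.symm) (fst_symm_ne d')
  · intro e he
    rw [mem_filter, mem_image] at he
    obtain ⟨⟨c, hc, rfl⟩, hv⟩ := he
    rcases Sym2.mem_iff.1 hv with rfl | rfl
    · exact ⟨c, by rw [mem_filter, mem_orbitSupport_symm]; exact ⟨mem_image_of_mem _ hc, rfl⟩, rfl⟩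
    · refine ⟨c.symm, ?_, c.edge_symm⟩
      rw [mem_filter, mem_orbitSupport_symm, SimpleGraph.Dart.edge_symm]
      exact ⟨mem_image_of_mem _ hc, rfl⟩

/-- The partition function as a sum over sets of oriented edges. -/
lemma partitionFunction_eq_sum (w : Sym2 V → ℝ) :
    partitionFunction G w =
      ∑ C ∈ (lowerDarts (SimpleGraph.Dart.symm (G := G))).powerset with
        ∀ v, Even #{e ∈ C.image SimpleGraph.Dart.edge | v ∈ e}, ∏ c ∈ C, w c.edge := by
  have hinj : Set.InjOn SimpleGraph.Dart.edge
      (lowerDarts (SimpleGraph.Dart.symm (G := G)) : Set G.Dart) := by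
    intro c hc c' hc' h
    rcases SimpleGraph.dart_edge_eq_iff _ _ |>.1 h with h | rfl
    · exact h
    · simp only [lowerDarts, coe_filter, mem_univ, true_and, Set.mem_ofPred_eq,
        SimpleGraph.Dart.symm_symm] at hc hc'
      exact absurd hc hc'.le.not_gt
  have himage {C' : Finset (Sym2 V)} (hC' : C' ⊆ G.edgeFinset) :
      image SimpleGraph.Dart.edge {c ∈ lowerDarts (SimpleGraph.Dart.symm (G := G)) | c.edge ∈ C'} =
        C' := by
    ext e
    simp only [mem_image, mem_filter]
    constructor
    · rintro ⟨c, hc, rfl⟩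
      exact hc.2
    · intro he
      have hd := edge_edgeDart G ⟨e, SimpleGraph.mem_edgeFinset.1 (hC' he)⟩
      generalize edgeDart G _ = d at hd
      simp only at hd
      subst hd
      rcases lt_or_gt_of_ne d.symm_ne with h | h
      · exact ⟨d.symm, ⟨by simpa [lowerDarts] using h, by rwa [d.edge_symm]⟩, d.edge_symm⟩
      · exact ⟨d, ⟨by simpa [lowerDarts] using h, he⟩, rfl⟩
  symm
  refine Finset.sum_bij' (fun C _ => C.image SimpleGraph.Dart.edge)
    (fun C' _ => {c ∈ lowerDarts (SimpleGraph.Dart.symm (G := G)) | c.edge ∈ C'}) ?_ ?_ ?_ ?_ ?_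
  · intro C hC
    simp only [mem_filter, mem_powerset] at hC
    simp only [closedCurves, mem_filter, mem_powerset]
    refine ⟨fun e he => ?_, fun v => by convert hC.2 v⟩
    obtain ⟨c, _, rfl⟩ := mem_image.1 he
    exact SimpleGraph.mem_edgeFinset.2 c.edge_mem
  · intro C' hC'
    simp only [closedCurves, mem_filter, mem_powerset] at hC'
    simp only [mem_filter, mem_powerset]
    refine ⟨Finset.filter_subset _ _, ?_⟩
    rw [himage hC'.1]
    exact fun v => by convert hC'.2 v
  · intro C hC
    simp only [mem_filter, mem_powerset] at hC
    ext c
    simp only [mem_filter, mem_image]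
    constructor
    · rintro ⟨hc, c', hc', h⟩
      exact hinj (hC.1 hc') hc h ▸ hc'
    · exact fun hc => ⟨hC.1 hc, c, hc, rfl⟩
  · intro C' hC'
    simp only [closedCurves, mem_filter, mem_powerset] at hC'
    exact himage hC'.1
  · intro C hC
    simp only [mem_filter, mem_powerset] at hC
    rw [Finset.prod_image fun c hc c' hc' h => hinj (hC.1 hc) (hC.1 hc') h]

/-- The hypothesis `hface` carries the topology: it supplies the face potentials that make the
crossing form linear on cycles. With the chord signs built from that linear form, every closed curve
enters the Pfaffian expansion with coefficient `+1`. -/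
theorem hasPfaffianRepresentation_of_slot {N : ℕ} (num : V ≃ Fin N)
    (slot : Fin N × Fin 4 ≃ G.Dart) (hfst : ∀ v i, (slot (v, i)).fst = num.symm v)
    (hslot : ∀ v i u j, slot (v, i) < slot (u, j) ↔ v < u ∨ v = u ∧ i < j)
    (hface : ∀ x : G.Dart → ZMod 2, (∀ d, x d.symm = x d) →
      (∀ v, ∑ i, x (slot (v, i)) = 0) →
      ∃ g : G.Dart → ZMod 2, (∀ v i, g (slot (v, i)).symm = g (slot (v, i + 1))) ∧
        ∀ d, x d = g d + g d.symm) :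
    HasPfaffianRepresentation G := by
  have hbar : Function.Involutive (SimpleGraph.Dart.symm (G := G)) :=
    SimpleGraph.Dart.symm_involutive
  obtain ⟨ε, hε⟩ := exists_crossingForm_eq_sum hbar (fun d => d.symm_ne) slot hslot hface
  have hcard : Fintype.card G.Dart = 2 * (2 * N) := by
    rw [← Fintype.card_congr slot]
    simp
    ring
  set enum := Fintype.orderIsoFinOfCardEq G.Dart hcard
  set σ : G.Dart → ℂ := chordSign SimpleGraph.Dart.symm ε
  have hvert (v : Fin N) (i : Fin 4) : num (slot (v, i)).fst = v := by simp [hfst]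
  have hmono : Monotone fun d : G.Dart => num d.fst := by
    intro d d' h
    obtain ⟨⟨v, i⟩, rfl⟩ := slot.surjective d
    obtain ⟨⟨u, j⟩, rfl⟩ := slot.surjective d'
    simp only [hvert]
    rcases h.lt_or_eq with h | h
    · rcases (hslot _ _ _ _).1 h with h | h
      · exact h.le
      · exact h.1.le
    · exact (Prod.mk.inj (slot.injective h)).1.le
  have hsum (x : G.Dart → ZMod 2) (v : Fin N) :
      ∑ d : G.Dart with num d.fst = v, x d = ∑ i, x (slot (v, i)) := by
    rw [Finset.sum_filter, ← slot.sum_comp, Fintype.sum_prod_type, Fintype.sum_eq_single v]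
    · simp [hvert]
    · intro u hu
      simp [hvert, hu]
  have hpar (S : Finset G.Dart) (v : Fin N) :
      ∑ i, (if slot (v, i) ∈ S then 1 else 0 : ZMod 2) = 0 ↔ Even #{d ∈ S | num d.fst = v} := by
    rw [← hsum (fun d => if d ∈ S then 1 else 0) v, ← ZMod.natCast_eq_zero_iff_even,
      Finset.sum_boole, Finset.filter_filter]
    have : ({d | num d.fst = v ∧ d ∈ S} : Finset G.Dart) = {d ∈ S | num d.fst = v} := by
      ext d
      simp [and_comm]
    rw [this]
  -- A vertex has four darts, so the used and the unused ones have the same parity.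
  have hcompl (C : Finset G.Dart) (v : Fin N) :
      Even #{d ∈ orbitCompl SimpleGraph.Dart.symm C | num d.fst = v} ↔
        Even #{d ∈ orbitSupport SimpleGraph.Dart.symm C | num d.fst = v} := by
    rw [← hpar, ← hpar, Fin.sum_univ_four, Fin.sum_univ_four]
    simp only [mem_orbitCompl]
    generalize orbitSupport SimpleGraph.Dart.symm C = S
    by_cases h0 : slot (v, 0) ∈ S <;> by_cases h1 : slot (v, 1) ∈ S <;>
      by_cases h2 : slot (v, 2) ∈ S <;> by_cases h3 : slot (v, 3) ∈ S <;>
      simp only [h0, h1, h2, h3, not_true, not_false_eq_true, if_true, if_false] <;> decide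
  refine ⟨2 * N, enum.toEquiv, slotMatching num slot hfst, signMatrix σ, 1,
    slotMatching_isPerfectMatching num slot hfst, signMatrix_isIncidenceMatrix σ, one_ne_zero,
    fun w _ => ?_⟩
  set B := weightedMatrix (slotMatching num slot hfst) (signMatrix σ) w with hB
  have hBapply (a b : G.Dart) : B a b = _ := weightedMatrix_slotMatching num slot hfst _ w a b
  have hpf := pfaffian_expansion enum hmono hbar
    (fun d h => fst_symm_ne d (num.injective h)) B (by
      ext a b
      rw [Matrix.transpose_apply, Matrix.neg_apply, hBapply, hBapply, signMatrix_antisymm σ a b]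
      by_cases h : b = a.symm
      · subst h
        simp
      · have h' : a ≠ b.symm := by
          rintro rfl
          exact h b.symm_symm.symm
        rw [if_neg h, if_neg h']) (by
      intro a b hab h
      have h := num.injective h
      rw [hBapply, if_neg]
      · simp [signMatrix, h, hab]
      · rintro rfl
        exact fst_symm_ne a h.symm) (by
      intro a b h h'
      have h : a.fst ≠ b.fst := fun h'' => h (by rw [h''])
      rw [hBapply, if_neg h']
      simp [signMatrix, h, h'])
  rw [matchedEdges_slotMatching, Finset.prod_empty, div_one, Complex.ofReal_one, one_mul, one_mul]
  change _ = pfaffian (B.submatrix enum enum)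
  rw [hpf, partitionFunction_eq_sum, Complex.ofReal_sum]
  refine Finset.sum_congr ?_ ?_
  · ext C
    simp only [mem_filter, mem_powerset]
    refine and_congr_right fun _ => ?_
    rw [num.forall_congr_left]
    refine forall_congr' fun v => ?_
    rw [hcompl, ← card_orbitSupport_fiber]
    simp only [Equiv.eq_symm_apply]
  · intro C hC
    simp only [mem_filter, mem_powerset] at hC
    have hedge : ∏ c ∈ C, B c c.symm = (∏ c ∈ C, σ c) * ((∏ c ∈ C, w c.edge : ℝ) : ℂ) := by
      rw [Complex.ofReal_prod, ← Finset.prod_mul_distrib]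
      refine Finset.prod_congr rfl fun c hc => ?_
      have hlt : c < c.symm := by simpa [lowerDarts] using hC.1 hc
      rw [hBapply, if_pos rfl, signMatrix, Matrix.of_apply, if_neg (fst_symm_ne c).symm, if_pos rfl,
        if_pos hlt, mul_comm]
    have hsign : (-1 : ℂ) ^ (crossings SimpleGraph.Dart.symm C +
        inversions (orbitSupport SimpleGraph.Dart.symm C)
          (orbitCompl SimpleGraph.Dart.symm C)) * ∏ c ∈ C, σ c = 1 := by
      refine neg_one_pow_crossings hbar hC.1 ε ?_
      rw [hε]
      · simp only [mul_ite, mul_one, mul_zero]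
        rw [← Finset.sum_filter]
        refine Finset.sum_congr ?_ fun _ _ => rfl
        ext c
        rw [mem_filter]
        exact ⟨fun h => (mem_orbitSupport_of_mem_lowerDarts hbar h.1 hC.1).1 h.2,
          fun h => ⟨hC.1 h, (mem_orbitSupport_of_mem_lowerDarts hbar (hC.1 h) hC.1).2 h⟩⟩
      · intro d
        simp only [mem_orbitSupport_symm, SimpleGraph.Dart.edge_symm]
      · intro v
        convert (hpar (orbitSupport SimpleGraph.Dart.symm C) v).2 ((hcompl C v).1 (hC.2 v))
    rw [hedge, ← mul_assoc, hsign, one_mul]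

/-- A connected `4`-regular graph with an embedding of genus zero has a Pfaffian representation. -/
theorem RotationSystem.hasPfaffianRepresentation {V : Type*} [Fintype V] [DecidableEq V]
    {G : SimpleGraph V} [DecidableRel G.Adj] (ρ : RotationSystem G)
    (hreg : G.IsRegularOfDegree 4) (hG : G.Connected)
    (hcard : Nat.card G.edgeSet + 2 ≤ Nat.card V +
      Nat.card (Quotient (Equiv.Perm.SameCycle.setoid ρ.facePerm))) :
    HasPfaffianRepresentation G := by
  set num := Fintype.equivFin V
  obtain ⟨slot, hfst, hnext⟩ := ρ.exists_slot hreg num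
  -- The lexicographic order on (vertex, position) makes vertices intervals and positions follow the
  -- rotation.
  let _ : LinearOrder G.Dart := LinearOrder.lift' (fun d => toLex (slot.symm d))
    fun d d' h => slot.symm.injective (toLex.injective h)
  refine hasPfaffianRepresentation_of_slot num slot hfst (fun v i u j => ?_) fun x hx hx' => ?_
  · change toLex (slot.symm (slot (v, i))) < toLex (slot.symm (slot (u, j))) ↔ _
    rw [Equiv.symm_apply_apply, Equiv.symm_apply_apply, Prod.Lex.toLex_lt_toLex]
  · obtain ⟨g, hg, hxg⟩ := ρ.exists_dart_potential hG hcard x hx fun v => by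
      rw [← hx' (num v), Finset.sum_filter, ← slot.sum_comp, Fintype.sum_prod_type,
        Fintype.sum_eq_single (num v)]
      · simp [hfst]
      · intro u hu
        have : num.symm u ≠ v := fun h => hu (by rw [← h, Equiv.apply_symm_apply])
        simp [hfst, this]
    exact ⟨g, fun v i => by rw [hg, hnext], hxg⟩

end Assembly

end PfaffianIsing

end

theorem proposition3p8 {V : Type*} [Fintype V] [DecidableEq V] (G : SimpleGraph V)
    [DecidableRel G.Adj] (hreg : G.IsRegularOfDegree 4)
    (hconn : PfaffianIsing.IsTwoConnected G) (hplanar : PfaffianIsing.IsPlanar G) :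
    PfaffianIsing.HasPfaffianRepresentation G := by
  obtain ⟨ρ, hρ⟩ := hplanar
  have hG := hconn.2.1
  refine ρ.hasPfaffianRepresentation hreg hG ?_
  -- With degree four there are no isolated vertices, and connectedness gives one component, so the
  -- planarity equation becomes `V - E + F = 2` with `F` the number of face cycles.
  have hiso : IsEmpty {v : V // ∀ w, ¬ G.Adj v w} := by
    refine ⟨fun ⟨v, hv⟩ => ?_⟩
    have h : 0 < G.degree v := by rw [hreg v]; norm_num
    obtain ⟨w, hw⟩ := (G.degree_pos_iff_exists_adj v).1 h
    exact hv w hw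
  have hcomp : Nat.card G.ConnectedComponent = 1 := by
    rw [Nat.card_eq_one_iff_unique]
    exact ⟨hG.preconnected.subsingleton_connectedComponent,
      hG.nonempty.map G.connectedComponentMk⟩
  rw [PfaffianIsing.RotationSystem.numFaces, Nat.card_of_isEmpty (α := {v : V // _}), hcomp] at hρ
  omega
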